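/- **Linear Interpretation Theorem.** *Linear permutation groups.* Let $L$ be a dense chain without endpoints having more than one element, and let $G$ be a subgroup of $\mathrm{Aut}(L,<)$. The intervals of $L$ are the sets $(x,y)$ with $x<y$, $(-\infty,x)$, $(x,\infty)$, and $L$. For sets $A, B\subseteq L$, $A<B$ means that $A,B$ are nonempty and $a<b$ for all $a\in A$, $b\in B$. $\langle L,G\rangle$ is *2-interval-transitive* if for all intervals $I_1<I_2$ and $J_1<J_2$ of $L$ there is $g\in G$ with $g(I_i)\cap J_i\neq\emptyset$ for $i=1,2$. Let $\bar L$ be the Dedekind completion of $L$ without endpoints, with its order topology; every $g\in G$ extends uniquely to an automorphism of $\bar L$, also denoted $g$. Let $\mathrm{supp}(g)=\{x\in\bar L: g(x)\ne x\}$; $g$ is *bounded* if $\mathrm{supp}(g)\subseteq (x,y)$ for some $x<y$ in $\bar L$. Let $K$ be the class of all 2-interval-transitive $\langle L,G\rangle$ such that $G$ has a nonidentity bounded element. *The actions.* For $g\in G$ let $\mathrm{var}(g)=\mathrm{int}(\mathrm{cl}(\mathrm{supp}(g)))$, and let $\mathrm{Ep}(L,G)\subseteq\bar L$ be the ($G$-invariant)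 set of all endpoints in $\bar L$ of the convex hulls of the sets $\mathrm{var}(g)$, $g\in G$. For a chain $X$, let $\mathrm{Ed}^X(x_1,x_2,y_1,y_2)$ be the relation $(x_1<x_2\wedge y_1<y_2)\vee(x_1>x_2\wedge y_1>y_2)$. Let $\mathrm{EP}(L,G)$ be $\mathrm{Ep}(L,G)$ equipped with the restriction of $\mathrm{Ed}^{\bar L}$, and let the *relaxed* Dedekind completion $\bar L^{\mathrm{rel}}$ be $\bar L$ equipped with $\mathrm{Ed}^{\bar L}$. For $G$ acting on a structure $M$, $\mathrm{ACT}(M,G)$ is the structure whose universe is the disjoint union of $M$ and $G$, with the relations of $M$, the multiplication of $G$, the application $(g,a)\mapsto g(a)$ (the latter two regarded as ternary relations), and unary predicates for $M$ and for $G$. *Strong interpretations.* Let $\mathcal R$ be a class of pairs $\langle M,M^*\rangle$ of structures, in languages $\mathcal L$ and $\mathcal L^*$, with $\mathcal L^*$ relational and $|M|\subseteq|M^*|$. The structures $M^*$ are *first-order strongly interpretable* in the structures $M$ (relative to $\mathcal R$) if there are $n$ and first-order $\mathcal L$-formulas $\varphi_U(\vec x)$, $\varphi_{Eq}(\vec x,\vec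 y)$, $\varphi_R(\vec x^1,\dots,\vec x^m)$ for each $m$-place relation symbol $R$ of $\mathcal L^*$, and $\varphi_{Imap}(\vec x,x)$, where all tuples have length $n$ and $x$ is a single variable, such that for each $\langle M,M^*\rangle\in\mathcal R$ there is a map $\mu$ from $\{\vec a\in|M|^n: M\models\varphi_U[\vec a]\}$ onto $|M^*|$ such that, for all tuples in its domain, $\mu(\vec a)=\mu(\vec b)$ iff $M\models\varphi_{Eq}[\vec a,\vec b]$; $\langle\mu(\vec a^1),\dots,\mu(\vec a^m)\rangle\in R^{M^*}$ iff $M\models\varphi_R[\vec a^1,\dots,\vec a^m]$; and $$\{\langle\vec a,\mu(\vec a)\rangle:\mu(\vec a)\in|M|\}=\{\langle\vec a,b\rangle\in|M|^n\times|M|: M\models\varphi_{Imap}[\vec a,b]\}.$$ *Second-order strongly interpretable* is defined in the same way, but with second-order formulas (full semantics, with quantification over elements, $k$-place relations and $k$-place functions), where each $\vec x$ is a finite tuple of element, relation and function variables; the last variable $x$ of $\varphi_{Imap}$ is still an element variable. **Theorem.** (1) The structures $\mathrm{ACT}(\mathrm{EP}(L,G),G)$ are first-order strongly interpretable in the groups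 $G$ (in the language of groups), relative to $\{\langle G,\mathrm{ACT}(\mathrm{EP}(L,G),G)\rangle:\langle L,G\rangle\in K\}$. (2) The structures $\mathrm{ACT}(\bar L^{\mathrm{rel}},G)$ are second-order strongly interpretable in the groups $G$ (in the language of groups), relative to $\{\langle G,\mathrm{ACT}(\bar L^{\mathrm{rel}},G)\rangle:\langle L,G\rangle\in K\}$. -/

import Mathlib

universe u v

namespace LinInterp

open FirstOrder FirstOrder.Language Set

/-! ### Second order logic (full semantics) -/

/-- The kinds of variables of second order logic: element variables, variables for `k`-place
relations, and variables for `k`-place functions. -/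
inductive VarKind : Type
  | elem : VarKind
  | rel : ℕ → VarKind
  | func : ℕ → VarKind

/-- The values that a variable of a given kind can take in a structure with universe `M`. -/
def VarKind.Val (M : Type u) : VarKind → Type u
  | .elem => M
  | .rel k => (Fin k → M) → Prop
  | .func k => (Fin k → M) → M

/-- A context `X : VarKind → Type` lists the free variables: `X κ` is the type of the free variables
of kind `κ`.  `Ext X κ₀` is the context `X` with one further variable, of kind `κ₀`. -/
inductive Ext (X : VarKind → Type) (κ₀ : VarKind) : VarKind → Type
  | old {κ : VarKind} (x : X κ) : Ext X κ₀ κ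
  | new : Ext X κ₀ κ₀

/-- An assignment of values in `M` to the variables of a context. -/
def Assignment (X : VarKind → Type) (M : Type u) : Type u :=
  ∀ κ : VarKind, X κ → κ.Val M

/-- Extend an assignment by a value for the new variable. -/
def Assignment.extend {X : VarKind → Type} {M : Type u} (v : Assignment X M) {κ₀ : VarKind}
    (a : κ₀.Val M) : Assignment (Ext X κ₀) M
  | _, .old x => v _ x
  | _, .new => a

/-- Terms of second order logic over the language `𝓛`, with variables from the context `X`. -/
inductive SOTerm (𝓛 : FirstOrder.Language.{0, 0}) (X : VarKind → Type) : Type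
  | var (x : X .elem) : SOTerm 𝓛 X
  | app {k : ℕ} (F : X (.func k)) (ts : Fin k → SOTerm 𝓛 X) : SOTerm 𝓛 X
  | func {k : ℕ} (f : 𝓛.Functions k) (ts : Fin k → SOTerm 𝓛 X) : SOTerm 𝓛 X

/-- Formulas of second order logic over the language `𝓛` whose free variables are those of the
context `X`.  The quantifier `all κ` binds one new variable of kind `κ`; the other connectives and
the existential quantifiers are definable from the given ones. -/
inductive SOFormula (𝓛 : FirstOrder.Language.{0, 0}) : (VarKind → Type) → Type 1
  | falsum {X : VarKind → Type} : SOFormula 𝓛 X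
  | equal {X : VarKind → Type} (s t : SOTerm 𝓛 X) : SOFormula 𝓛 X
  | rel {X : VarKind → Type} {k : ℕ} (R : 𝓛.Relations k) (ts : Fin k → SOTerm 𝓛 X) : SOFormula 𝓛 X
  | relVar {X : VarKind → Type} {k : ℕ} (R : X (.rel k)) (ts : Fin k → SOTerm 𝓛 X) : SOFormula 𝓛 X
  | imp {X : VarKind → Type} (φ ψ : SOFormula 𝓛 X) : SOFormula 𝓛 X
  | all {X : VarKind → Type} (κ : VarKind) (φ : SOFormula 𝓛 (Ext X κ)) : SOFormula 𝓛 X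

/-- The value of a term. -/
def SOTerm.realize {𝓛 : FirstOrder.Language.{0, 0}} {X : VarKind → Type} {M : Type u} [𝓛.Structure M]
    (v : Assignment X M) : SOTerm 𝓛 X → M
  | .var x => v .elem x
  | .app (k := k) F ts => v (.func k) F (fun i => (ts i).realize v)
  | .func f ts => Structure.funMap f (fun i => (ts i).realize v)

/-- Truth of a second order formula; relation and function variables range over *all* relations and
functions on the universe. -/
def SOFormula.Realize {𝓛 : FirstOrder.Language.{0, 0}} {M : Type u} [𝓛.Structure M] :
    {X : VarKind → Type} → SOFormula 𝓛 X → Assignment X M → Prop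
  | _, .falsum, _ => False
  | _, .equal s t, v => s.realize v = t.realize v
  | _, .rel R ts, v => Structure.RelMap R (fun i => (ts i).realize v)
  | _, .relVar (k := k) R ts, v => v (.rel k) R (fun i => (ts i).realize v)
  | _, .imp φ ψ, v => φ.Realize v → ψ.Realize v
  | _, .all κ φ, v => ∀ a : κ.Val M, φ.Realize (v.extend a)

/-! ### Strong interpretations

A subuniverse system is given by a family of pairs `(M i, Ms i)` of an `𝓛`-structure and an
`𝓛s`-structure, together with an inclusion of the universe of `M i` in that of `Ms i`.  The
interpreted language `𝓛s` is relational: in an interpretation, functions are treated as relations. -/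

/-- The structures `Ms i` are *first order strongly interpretable* in the structures `M i`: there are
first order formulas `φU`, `φEq`, `φR` (one for every relation symbol) and `φImap`, not depending on
`i`, such that for every `i` there is an interpreting mapping `μ` from the set of `n`-tuples of `M i`
satisfying `φU` onto `Ms i`, for which `φEq` defines equality of values, `φR` defines the preimage of
the relation `R`, and `φImap` defines the graph of `μ` restricted to the tuples with value
in `M i`. -/
def FOStrInterpretable (𝓛 𝓛s : FirstOrder.Language.{0, 0}) [𝓛s.IsRelational] {ι : Type v} (M Ms : ι → Type u)
    [∀ i, 𝓛.Structure (M i)] [∀ i, 𝓛s.Structure (Ms i)] (incl : ∀ i, M i ↪ Ms i) : Prop :=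
  ∃ (n : ℕ) (φU : 𝓛.Formula (Fin n)) (φEq : 𝓛.Formula (Fin n ⊕ Fin n))
    (φR : ∀ m : ℕ, 𝓛s.Relations m → 𝓛.Formula (Fin m × Fin n))
    (φImap : 𝓛.Formula (Fin n ⊕ Unit)),
    ∀ i : ι, ∃ μ : {a : Fin n → M i // φU.Realize a} → Ms i,
      Function.Surjective μ ∧
      (∀ a b, μ a = μ b ↔ φEq.Realize (Sum.elim a.1 b.1)) ∧
      (∀ (m : ℕ) (R : 𝓛s.Relations m) (a : Fin m → {a : Fin n → M i // φU.Realize a}),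
        Structure.RelMap R (fun j => μ (a j)) ↔ (φR m R).Realize (fun p => (a p.1).1 p.2)) ∧
      (∀ (a : Fin n → M i) (b : M i),
        φImap.Realize (Sum.elim a (fun _ => b)) ↔ ∃ h : φU.Realize a, μ ⟨a, h⟩ = incl i b)

/-- The structures `Ms i` are *second order strongly interpretable* in the structures `M i`: as for
`FOStrInterpretable`, but the formulas are second order and the tuples on which the interpreting
mappings are defined are finite tuples of elements, relations and functions; the last free variable
of `φImap` is an element variable. -/
def SOStrInterpretable (𝓛 𝓛s : FirstOrder.Language.{0, 0}) [𝓛s.IsRelational] {ι : Type v} (M Ms : ι → Type u)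
    [∀ i, 𝓛.Structure (M i)] [∀ i, 𝓛s.Structure (Ms i)] (incl : ∀ i, M i ↪ Ms i) : Prop :=
  ∃ (X : VarKind → Type) (_ : Finite (Σ κ : VarKind, X κ)) (φU : SOFormula 𝓛 X)
    (φEq : SOFormula 𝓛 (fun κ => X κ ⊕ X κ))
    (φR : ∀ m : ℕ, 𝓛s.Relations m → SOFormula 𝓛 (fun κ => Fin m × X κ))
    (φImap : SOFormula 𝓛 (Ext X .elem)),
    ∀ i : ι, ∃ μ : {a : Assignment X (M i) // φU.Realize a} → Ms i,
      Function.Surjective μ ∧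
      (∀ a b, μ a = μ b ↔ φEq.Realize (fun κ => Sum.elim (a.1 κ) (b.1 κ))) ∧
      (∀ (m : ℕ) (R : 𝓛s.Relations m) (a : Fin m → {a : Assignment X (M i) // φU.Realize a}),
        Structure.RelMap R (fun j => μ (a j)) ↔
          (φR m R).Realize (fun κ p => (a p.1).1 κ p.2)) ∧
      (∀ (a : Assignment X (M i)) (b : M i),
        φImap.Realize (a.extend (κ₀ := .elem) b) ↔ ∃ h : φU.Realize a, μ ⟨a, h⟩ = incl i b)

/-! ### The languages and the structures -/

/-- The only symbol of the language of groups. -/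
inductive GroupFunc : ℕ → Type
  | mul : GroupFunc 2

/-- The language of groups, with a symbol for the multiplication. -/
def groupLang : FirstOrder.Language.{0, 0} := ⟨GroupFunc, fun _ => Empty⟩

instance groupStructure (G : Type u) [Group G] : groupLang.Structure G where
  funMap := fun {_} f =>
    match f with
    | GroupFunc.mul => fun x => x 0 * x 1
  RelMap := fun {_} r => Empty.elim r

/-- The only symbol of the language of equal direction structures. -/
inductive EdRel : ℕ → Type
  | ed : EdRel 4

/-- The language of equal direction structures. -/
def edLang : FirstOrder.Language.{0, 0} := ⟨fun _ => Empty, EdRel⟩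

/-- The equal direction relation of a linear order. -/
def Ed {X : Type u} [LT X] (x₁ x₂ y₁ y₂ : X) : Prop :=
  (x₁ < x₂ ∧ y₁ < y₂) ∨ (x₁ > x₂ ∧ y₁ > y₂)

/-- The equal direction structure of a linear order. -/
instance edStructure (X : Type u) [LT X] : edLang.Structure X where
  funMap := fun {_} f => Empty.elim f
  RelMap := fun {_} r =>
    match r with
    | EdRel.ed => fun x => Ed (x 0) (x 1) (x 2) (x 3)

/-- The relation symbols of the language of actions of groups on relational `𝓛`-structures: those
of `𝓛`, the graphs of the (partial) operations of multiplication and of application, and predicates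
for the two sorts. -/
inductive ActRel (𝓛 : FirstOrder.Language.{0, 0}) : ℕ → Type
  | base {n : ℕ} (R : 𝓛.Relations n) : ActRel 𝓛 n
  | mul : ActRel 𝓛 3
  | ap : ActRel 𝓛 3
  | isPoint : ActRel 𝓛 1
  | isGroup : ActRel 𝓛 1

/-- The language of actions of groups on relational `𝓛`-structures. -/
def actLang (𝓛 : FirstOrder.Language.{0, 0}) : FirstOrder.Language.{0, 0} := ⟨fun _ => Empty, ActRel 𝓛⟩

instance actLang_isRelational (𝓛 : FirstOrder.Language.{0, 0}) : (actLang 𝓛).IsRelational :=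
  fun _ => inferInstanceAs (IsEmpty Empty)

/-- The universe of the structure `ACT(M, G)`: the disjoint union of `M` and `G`. -/
abbrev Act (M G : Type u) : Type u := M ⊕ G

/-- The structure `ACT(M, G)` of the action of a group `G` on a relational structure `M`. -/
instance actStructure (𝓛 : FirstOrder.Language.{0, 0}) (M G : Type u) [𝓛.Structure M] [Group G]
    [MulAction G M] : (actLang 𝓛).Structure (Act M G) where
  funMap := fun {_} f => Empty.elim f
  RelMap := fun {_} r =>
    match r with
    | ActRel.base R => fun x => ∃ y, x = (fun j => Sum.inl (y j)) ∧ Structure.RelMap R y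
    | ActRel.mul => fun x => ∃ g h : G, x = ![Sum.inr g, Sum.inr h, Sum.inr (g * h)]
    | ActRel.ap => fun x => ∃ (g : G) (a : M), x = ![Sum.inr g, Sum.inl a, Sum.inl (g • a)]
    | ActRel.isPoint => fun x => ∃ a : M, x = ![Sum.inl a]
    | ActRel.isGroup => fun x => ∃ g : G, x = ![Sum.inr g]

/-! ### The Dedekind completion without endpoints -/

/-- The Dedekind completion (without endpoints) of a chain: the Dedekind cuts both of whose halves
are nonempty. -/
def DCompl (L : Type u) [LinearOrder L] : Type u :=
  {c : DedekindCut L // c.left.Nonempty ∧ c.right.Nonempty}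

section DCompl

variable {L : Type u} [LinearOrder L]

noncomputable instance : LinearOrder (DCompl L) :=
  inferInstanceAs (LinearOrder {c : DedekindCut L // c.left.Nonempty ∧ c.right.Nonempty})

noncomputable instance : TopologicalSpace (DCompl L) := Preorder.topology (DCompl L)

instance : OrderTopology (DCompl L) := ⟨rfl⟩

/-- The canonical embedding of `L` in its Dedekind completion. -/
def DCompl.of (x : L) : DCompl L := ⟨DedekindCut.principal x, ⟨x, le_rfl⟩, ⟨x, le_rfl⟩⟩

/-- The image of a cut under an automorphism. -/
def mapCut (g : L ≃o L) (c : DedekindCut L) : DedekindCut L where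
  extent := g '' c.left
  intent := g '' c.right
  upperPolar_extent := by
    have h : upperBounds (g '' c.left) = g '' upperBounds c.left := OrderIso.upperBounds_image g
    rw [DedekindCut.upperBounds_left] at h
    exact h
  lowerPolar_intent := by
    have h : lowerBounds (g '' c.right) = g '' lowerBounds c.right := OrderIso.lowerBounds_image g
    rw [DedekindCut.lowerBounds_right] at h
    exact h

/-- The automorphisms of `L` act on the Dedekind completion: `g • x` is the value at `x` of the unique
extension of `g` to an automorphism of the completion. -/
instance : MulAction (L ≃o L) (DCompl L) where
  smul g x := ⟨mapCut g x.1, x.2.1.image g, x.2.2.image g⟩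
  one_smul x := Subtype.ext (DedekindCut.ext (image_id x.1.left))
  mul_smul g h x := Subtype.ext (DedekindCut.ext (image_comp g h x.1.left))

theorem smul_of (g : L ≃o L) (x : L) : g • DCompl.of x = DCompl.of (g x) :=
  Subtype.ext (DedekindCut.ext (OrderIso.image_Iic g x))

theorem smul_le_smul (g : L ≃o L) {x y : DCompl L} (h : x ≤ y) : g • x ≤ g • y := by
  have h' : x.1.left ⊆ y.1.left := Concept.extent_subset_extent_iff.2 h
  exact Concept.extent_subset_extent_iff.1 (image_mono (f := g) h')

/-- The extension of an automorphism of `L` to the completion, as an automorphism of the chain. -/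
def extendIso (g : L ≃o L) : DCompl L ≃o DCompl L where
  toEquiv := MulAction.toPerm g
  map_rel_iff' := by
    intro x y
    refine ⟨fun h => ?_, fun h => smul_le_smul g h⟩
    have h' := smul_le_smul g⁻¹ h
    simpa using h'

@[simp] theorem extendIso_apply (g : L ≃o L) (x : DCompl L) : extendIso g x = g • x := rfl

/-- The support of an automorphism, a subset of the completion. -/
def supp (g : L ≃o L) : Set (DCompl L) := {x | g • x ≠ x}

/-- The regular open set `int (cl (supp g))`. -/
def var (g : L ≃o L) : Set (DCompl L) := interior (closure (supp g))

/-- The convex hull of a set in a chain. -/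
def hull {X : Type u} [LinearOrder X] (U : Set X) : Set X := {z | ∃ x ∈ U, ∃ y ∈ U, x ≤ z ∧ z ≤ y}

/-- The endpoints, in the completion, of the convex hull of a set. -/
def Ep (U : Set (DCompl L)) : Set (DCompl L) := {x | IsLUB (hull U) x ∨ IsGLB (hull U) x}

theorem supp_conj (g h : L ≃o L) : supp (h * g * h⁻¹) = extendIso h '' supp g := by
  ext x
  constructor
  · intro hx
    refine ⟨h⁻¹ • x, fun hg => hx ?_, by simp⟩
    rw [mul_smul, mul_smul, hg, smul_inv_smul]
  · rintro ⟨y, hy, rfl⟩ hg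
    apply hy
    simpa [mul_smul] using hg

theorem var_conj (g h : L ≃o L) : var (h * g * h⁻¹) = extendIso h '' var g := by
  have h1 := (extendIso h).toHomeomorph.image_closure (supp g)
  have h2 := (extendIso h).toHomeomorph.image_interior (closure (supp g))
  rw [h1] at h2
  rw [var, var, supp_conj]
  exact h2.symm

theorem hull_image (e : DCompl L ≃o DCompl L) (U : Set (DCompl L)) :
    hull (e '' U) = e '' hull U := by
  ext z
  constructor
  · rintro ⟨_, ⟨x, hx, rfl⟩, _, ⟨y, hy, rfl⟩, h1, h2⟩
    exact ⟨e.symm z, ⟨x, hx, y, hy, (e.le_symm_apply).2 h1, (e.symm_apply_le).2 h2⟩, by simp⟩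
  · rintro ⟨z, ⟨x, hx, y, hy, h1, h2⟩, rfl⟩
    exact ⟨e x, ⟨x, hx, rfl⟩, e y, ⟨y, hy, rfl⟩, e.monotone h1, e.monotone h2⟩

theorem Ep_conj (g h : L ≃o L) {x : DCompl L} (hx : x ∈ Ep (var g)) :
    h • x ∈ Ep (var (h * g * h⁻¹)) := by
  rw [var_conj]
  unfold Ep at hx ⊢
  rw [mem_ofPred_eq, hull_image]
  exact hx.imp (fun H => (extendIso h).isLUB_image'.2 H) (fun H => (extendIso h).isGLB_image'.2 H)

/-- The `G`-invariant set `Ep(L, G)` of all endpoints of convex hulls of sets `var g` with `g` in `G`,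
with the action of `G`.  As a subtype of the completion it carries the induced equal direction
structure, and is then the structure `EP(L, G)`. -/
def EP (G : Subgroup (L ≃o L)) : SubMulAction G (DCompl L) where
  carrier := {x | ∃ g ∈ G, x ∈ Ep (var g)}
  smul_mem' := by
    rintro ⟨h, hh⟩ x ⟨g, hg, hx⟩
    exact ⟨h * g * h⁻¹, G.mul_mem (G.mul_mem hh hg) (G.inv_mem hh), Ep_conj g h hx⟩

/-- The intervals of a chain `L` (all of them open): bounded intervals, rays, and `L` itself. -/
def IsInterval (I : Set L) : Prop :=
  (∃ x y : L, x < y ∧ I = Ioo x y) ∨ (∃ x : L, I = Iio x) ∨ (∃ x : L, I = Ioi x) ∨ I = univ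

/-- `I 0 < I 1 < ⋯` for a finite sequence of subsets of a chain. -/
def SetsLT {n : ℕ} (I : Fin n → Set L) : Prop :=
  (∀ i, (I i).Nonempty) ∧ ∀ x : Fin n → L, (∀ i, x i ∈ I i) → StrictMono x

/-- `n`-interval-transitivity of a group of automorphisms of a chain. -/
def IntervalTransitive (n : ℕ) (G : Subgroup (L ≃o L)) : Prop :=
  ∀ I J : Fin n → Set L, (∀ i, IsInterval (I i)) → (∀ i, IsInterval (J i)) → SetsLT I → SetsLT J →
    ∃ g ∈ G, ∀ i, ((g '' I i) ∩ J i).Nonempty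

/-- An automorphism is bounded if its support is contained in a bounded interval. -/
def IsBounded (g : L ≃o L) : Prop := ∃ x y : DCompl L, x < y ∧ supp g ⊆ Ioo x y

end DCompl

/-- The class of the linear permutation groups `⟨L, G⟩` (`L` a dense chain without endpoints and with
more than one element, `G` a group of automorphisms of `L`) which are `n`-interval-transitive and
have a nonidentity bounded element. -/
structure KLN (n : ℕ) : Type (u + 1) where
  L : Type u
  [linearOrder : LinearOrder L]
  [nontrivial : Nontrivial L]
  [denselyOrdered : DenselyOrdered L]
  [noMinOrder : NoMinOrder L]
  [noMaxOrder : NoMaxOrder L]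
  G : Subgroup (L ≃o L)
  intervalTransitive : IntervalTransitive n G
  exists_bounded : ∃ g ∈ G, g ≠ 1 ∧ IsBounded g

attribute [instance] KLN.linearOrder KLN.nontrivial KLN.denselyOrdered KLN.noMinOrder KLN.noMaxOrder

end LinInterp

namespace LinInterp

open FirstOrder FirstOrder.Language Set Filter Topology

set_option linter.unusedSectionVars false
set_option linter.unusedVariables false

/-! ### Relations uniformly definable in groups -/

/-! The group is made to see supports, then order, then points. Density of supports comes from
conjugation: 2-interval-transitivity carries a bounded nonidentity element into any given interval,
so every nonempty open interval of the completion contains the support of some nonidentity element.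
Together with faithfulness, monotonicity and completeness, this is recorded in `LinAct`, and the
rest of the argument uses only these properties.

Disjointness of supports is first-order (`disj_iff`): `f` and `g` have disjoint supports iff every
`h` not commuting with `f` admits `f₁`, `f₂` centralizing `g` such that the iterated commutator of
`h` with `f₁` and `f₂` is nontrivial and centralizes `g`. Conjugation then expresses that `g` moves
the support of `a` onto a set meeting the support of `b` (`touch_iff`). An order-preserving map
cannot interchange supports lying on either side of each other, while 2-interval-transitivity
supplies an interchanging map whenever the supports are not separated. So the group defines
separated pairs (`sep_iff`) and agreement of their directions (`same_iff`). A choice of one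
direction is not defined; hence the equal direction relation instead of the order.

A point is coded by a separated pair `a`, `b`, fixing an orientation, and a set `P` of group
elements, the point being the infimum in that orientation of the union of their supports. Points are
compared through the supports lying on one side of them (`ptLe_iff`, `ptLe_smul_iff`). Singletons
`P` give exactly the endpoints of supports, hence `EP` and a first-order interpretation; arbitrary
`P` give all points of the completion and a second-order one. Codes with `a = b`, never separated,
are free to stand for group elements. `exists_decoding` treats both cases at once, and `Dfn` lets
one definability proof yield both kinds of formula. -/

/-- The relations of groups that are definable, uniformly in all groups, with element parameters
indexed by `α` and parameters for sets indexed by `β`, quantifying over elements only. -/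
inductive Dfn : ∀ {α β : Type},
    (∀ (G : Type u) [Group G], (α → G) → (β → G → Prop) → Prop) → Prop
  | mul {α β : Type} (a b c : α) : Dfn (β := β) fun G _ v _ => v a * v b = v c
  | eq {α β : Type} (a b : α) : Dfn (β := β) fun G _ v _ => v a = v b
  | pred {α β : Type} (b : β) (a : α) : Dfn fun G _ v p => p b (v a)
  | falsum {α β : Type} : Dfn (α := α) (β := β) fun _ _ _ _ => False
  | imp {α β : Type} {R S : ∀ (G : Type u) [Group G], (α → G) → (β → G → Prop) → Prop} :
      Dfn R → Dfn S → Dfn fun G _ v p => R G v p → S G v p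
  | all {α β : Type} {R : ∀ (G : Type u) [Group G], (α → G) → (β → G → Prop) → G → Prop} :
      Dfn (α := α ⊕ Unit)
        (fun G _ v p => R G (fun a => v (Sum.inl a)) p (v (Sum.inr ()))) →
      Dfn fun G _ v p => ∀ x, R G v p x

namespace Dfn

variable {α β : Type} {R S : ∀ (G : Type u) [Group G], (α → G) → (β → G → Prop) → Prop}

theorem congr (hR : Dfn R) (h : ∀ (G : Type u) [Group G] v p, S G v p ↔ R G v p) : Dfn S := by
  have : S = R := by
    funext G _ v p
    exact propext (h G v p)
  rwa [this]

theorem not (hR : Dfn R) : Dfn fun G _ v p => ¬ R G v p := hR.imp falsum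

theorem or (hR : Dfn R) (hS : Dfn S) : Dfn fun G _ v p => R G v p ∨ S G v p :=
  (hR.not.imp hS).congr fun _ _ _ _ => or_iff_not_imp_left

theorem and (hR : Dfn R) (hS : Dfn S) : Dfn fun G _ v p => R G v p ∧ S G v p :=
  (hR.imp hS.not).not.congr fun _ _ _ _ => by tauto

theorem ex {R : ∀ (G : Type u) [Group G], (α → G) → (β → G → Prop) → G → Prop}
    (hR : Dfn (α := α ⊕ Unit)
      (fun G _ v p => R G (fun a => v (Sum.inl a)) p (v (Sum.inr ())))) :
    Dfn fun G _ v p => ∃ x, R G v p x :=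
  (all (R := fun G _ v p x => ¬ R G v p x) hR.not).not.congr fun _ _ _ _ => by simp

theorem mul_eq_mul (a b c d : α) : Dfn (β := β) fun G _ v _ => v a * v b = v c * v d :=
  (ex (R := fun G _ v _ x => v a * v b = x ∧ v c * v d = x)
    ((mul (Sum.inl a) (Sum.inl b) (Sum.inr ())).and (mul (Sum.inl c) (Sum.inl d) (Sum.inr ())))).congr
    fun _ _ _ _ => by simp [eq_comm]

/-- The equation `e * (f * h) = h * f` says that `e` is the commutator of `h` and `f` without
mentioning inverses; `Disj` needs this shape. -/
theorem mul_mul_eq_mul (a b c d e : α) :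
    Dfn (β := β) fun G _ v _ => v a * (v b * v c) = v d * v e :=
  (ex (R := fun G _ v _ x => v b * v c = x ∧ v a * x = v d * v e)
    ((mul (Sum.inl b) (Sum.inl c) (Sum.inr ())).and
      (mul_eq_mul (Sum.inl a) (Sum.inr ()) (Sum.inl d) (Sum.inl e)))).congr
    fun _ _ _ _ => by simp

/-- A uniformly definable relation is first order definable when the set parameters are
singletons. -/
theorem exists_formula (hR : Dfn R) {γ : Type} (s : α → γ) (t : β → γ) :
    ∃ φ : groupLang.Formula γ, ∀ (G : Type u) [Group G] (v : γ → G),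
      φ.Realize v ↔ R G (fun a => v (s a)) (fun b x => x = v (t b)) := by
  induction hR generalizing γ with
  | mul a b c =>
    refine ⟨Term.equal (Term.func (GroupFunc.mul : groupLang.Functions 2)
      ![Term.var (s a), Term.var (s b)]) (Term.var (s c)), fun G _ v => ?_⟩
    rw [Formula.realize_equal]
    rfl
  | eq a b =>
    refine ⟨Term.equal (Term.var (s a)) (Term.var (s b)), fun G _ v => ?_⟩
    rw [Formula.realize_equal]
    rfl
  | pred b a =>
    refine ⟨Term.equal (Term.var (s a)) (Term.var (t b)), fun G _ v => ?_⟩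
    rw [Formula.realize_equal]
    rfl
  | falsum => exact ⟨⊥, fun G _ v => Iff.rfl⟩
  | imp _ _ ih ih' =>
    obtain ⟨φ, hφ⟩ := ih s t
    obtain ⟨ψ, hψ⟩ := ih' s t
    exact ⟨φ.imp ψ, fun G _ v => by rw [Formula.realize_imp, hφ, hψ]⟩
  | all _ ih =>
    obtain ⟨φ, hφ⟩ := ih (γ := γ ⊕ Unit) (Sum.map s id) (fun b => Sum.inl (t b))
    refine ⟨φ.iAlls Unit, fun G _ v => ?_⟩
    rw [Formula.realize_iAlls]
    refine ⟨fun h x => (hφ G _).1 (h fun _ => x), fun h i => (hφ G _).2 (h (i ()))⟩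

/-- A uniformly definable relation is second order definable. -/
theorem exists_soFormula (hR : Dfn R) {X : VarKind → Type} (s : α → X .elem) (t : β → X (.rel 1)) :
    ∃ φ : SOFormula groupLang X, ∀ (G : Type u) [Group G] (v : Assignment X G),
      φ.Realize v ↔ R G (fun a => v .elem (s a)) (fun b x => v (.rel 1) (t b) fun _ => x) := by
  induction hR generalizing X with
  | mul a b c =>
    refine ⟨.equal (.func (GroupFunc.mul : groupLang.Functions 2)
      ![.var (s a), .var (s b)]) (.var (s c)), fun G _ v => Iff.rfl⟩
  | eq a b => exact ⟨.equal (.var (s a)) (.var (s b)), fun G _ v => Iff.rfl⟩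
  | pred b a => exact ⟨.relVar (t b) fun _ => .var (s a), fun G _ v => Iff.rfl⟩
  | falsum => exact ⟨.falsum, fun G _ v => Iff.rfl⟩
  | imp _ _ ih ih' =>
    obtain ⟨φ, hφ⟩ := ih s t
    obtain ⟨ψ, hψ⟩ := ih' s t
    exact ⟨.imp φ ψ, fun G _ v => imp_congr (hφ G v) (hψ G v)⟩
  | all _ ih =>
    obtain ⟨φ, hφ⟩ := ih (X := Ext X .elem) (Sum.elim (fun a => .old (s a)) fun _ => .new)
      (fun b => .old (t b))
    exact ⟨.all .elem φ, fun G _ v => forall_congr' fun x => hφ G (v.extend (κ₀ := .elem) x)⟩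

end Dfn

/-! ### Geometric relations in terms of the group -/

section Predicates

variable {G : Type u} [Group G]

/-- A formula of the language of groups which says that `f` and `g` have disjoint supports: whenever
`h` does not commute with `f`, there are `f₁` and `f₂` in the centralizer of `g` for which
`⁅⁅h, f₁⁆, f₂⁆` is a nonidentity element of the centralizer of `g`. -/
def Disj (f g : G) : Prop :=
  ∀ h, ¬ f * h = h * f → ∃ f₁ f₂ e₁ e₂, f₁ * g = g * f₁ ∧ f₂ * g = g * f₂ ∧
    e₁ * (f₁ * h) = h * f₁ ∧ e₂ * (f₂ * e₁) = e₁ * f₂ ∧ ¬ e₂ * e₂ = e₂ ∧ e₂ * g = g * e₂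

/-- The element `g` moves the support of `a` to a set meeting the support of `b`. -/
def Touch (g a b : G) : Prop := ∃ x, g * a = x * g ∧ ¬ Disj x b

/-- The convex hulls of the supports of `a` and `b` are nonempty and disjoint. -/
def Sep (a b : G) : Prop :=
  ¬ a * a = a ∧ ¬ b * b = b ∧ ¬ ∃ g, Touch g a b ∧ Touch g b a

/-- The directions from `a` to `b` and from `c` to `d` are the same. -/
def Same (a b c d : G) : Prop := Sep a b ∧ Sep c d ∧ ∃ g, Touch g a c ∧ Touch g b d

variable (G) in
/-- Codes of group elements and of points of the completion.  The code `⟨a, a, f, P⟩` stands for the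
group element `f`; if `a` and `b` are separated, then `⟨a, b, f, P⟩` stands for the infimum, in the
order in which `a` comes before `b`, of the supports of the elements of `P`. -/
structure Code where
  a : G
  b : G
  f : G
  P : G → Prop

/-- In the order in which `s` comes before `t`, the point coded by `x` is a lower bound of the
nonempty support of `c`. -/
def PtLe (x : Code G) (s t c : G) : Prop :=
  (Same x.a x.b s t ∧ ∀ c', (∀ f, x.P f → Same s t c' f) → Same s t c' c) ∨
  (Same x.b x.a s t ∧ ∀ f, x.P f → Same s t f c)

/-- In the order in which `s` comes before `t`, the point coded by `x` is less than the point coded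
by `y`. -/
def PtLt (x y : Code G) (s t : G) : Prop := ∃ c, PtLe x s t c ∧ ¬ PtLe y s t c

/-- The element `g` maps the point coded by `x` to the point coded by `y`. -/
def PtAp (g : G) (x y : Code G) : Prop :=
  ¬ ∃ s t c c', g * c' = c * g ∧ PtLe x s t c' ∧ ¬ PtLe y s t c

/-- The code `x` is one of a group element. -/
def IsGp (x : Code G) : Prop := x.a = x.b

/-- The code `x` is one of a point. -/
def IsPt (x : Code G) : Prop :=
  Sep x.a x.b ∧ (∃ f, x.P f) ∧ ∃ c, ∀ f, x.P f → Same x.a x.b c f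

/-- Equality of the objects coded by `x` and `y`. -/
def CodeEq (x y : Code G) : Prop :=
  (IsGp x ∧ IsGp y ∧ x.f = y.f) ∨ (¬ IsGp x ∧ ¬ IsGp y ∧ ¬ ∃ s t, PtLt x y s t)

/-- The relations of the structure of an action, on codes. -/
def CodeRel : ∀ {m : ℕ}, (actLang edLang).Relations m → (Fin m → Code G) → Prop
  | _, .base EdRel.ed => fun x => (¬ IsGp (x 0) ∧ ¬ IsGp (x 1) ∧ ¬ IsGp (x 2) ∧ ¬ IsGp (x 3)) ∧
      ∃ s t, PtLt (x 0) (x 1) s t ∧ PtLt (x 2) (x 3) s t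
  | _, .mul => fun x => (IsGp (x 0) ∧ IsGp (x 1) ∧ IsGp (x 2)) ∧ (x 0).f * (x 1).f = (x 2).f
  | _, .ap => fun x => (IsGp (x 0) ∧ ¬ IsGp (x 1) ∧ ¬ IsGp (x 2)) ∧ PtAp (x 0).f (x 1) (x 2)
  | _, .isPoint => fun x => ¬ IsGp (x 0)
  | _, .isGroup => fun x => IsGp (x 0)

end Predicates

/-! ### Uniform definability of the geometric relations -/

namespace Dfn

variable {α β : Type}

theorem disj (a b : α) : Dfn.{u} (β := β) fun G _ v _ => Disj (v a) (v b) := by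
  refine all (.imp (not (mul_eq_mul _ _ _ _)) (ex (ex (ex (ex ?_)))))
  exact (mul_eq_mul _ _ _ _).and ((mul_eq_mul _ _ _ _).and ((mul_mul_eq_mul _ _ _ _ _).and
    ((mul_mul_eq_mul _ _ _ _ _).and ((not (mul _ _ _)).and (mul_eq_mul _ _ _ _)))))

theorem touch (g a b : α) : Dfn.{u} (β := β) fun G _ v _ => Touch (v g) (v a) (v b) :=
  ex ((mul_eq_mul _ _ _ _).and (disj _ _).not)

theorem sep (a b : α) : Dfn.{u} (β := β) fun G _ v _ => Sep (v a) (v b) :=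
  (not (mul _ _ _)).and ((not (mul _ _ _)).and (not (ex ((touch _ _ _).and (touch _ _ _)))))

theorem same (a b c d : α) : Dfn.{u} (β := β) fun G _ v _ => Same (v a) (v b) (v c) (v d) :=
  (sep _ _).and ((sep _ _).and (ex ((touch _ _ _).and (touch _ _ _))))

theorem ptLe (a b f : α) (P : β) (s t c : α) :
    Dfn.{u} fun G _ v p => PtLe ⟨v a, v b, v f, p P⟩ (v s) (v t) (v c) :=
  ((same a b s t).and (all (.imp (all (.imp (.pred P _) (same _ _ _ _))) (same _ _ _ _)))).or
    ((same b a s t).and (all (.imp (.pred P _) (same _ _ _ _))))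

theorem ptLt (a b f : α) (P : β) (a' b' f' : α) (P' : β) (s t : α) :
    Dfn.{u} fun G _ v p => PtLt ⟨v a, v b, v f, p P⟩ ⟨v a', v b', v f', p P'⟩ (v s) (v t) :=
  ex ((ptLe (Sum.inl a) (Sum.inl b) (Sum.inl f) P (Sum.inl s) (Sum.inl t) (Sum.inr ())).and
    (ptLe (Sum.inl a') (Sum.inl b') (Sum.inl f') P' (Sum.inl s) (Sum.inl t) (Sum.inr ())).not)

theorem ptAp (g a b f : α) (P : β) (a' b' f' : α) (P' : β) :
    Dfn.{u} fun G _ v p => PtAp (v g) ⟨v a, v b, v f, p P⟩ ⟨v a', v b', v f', p P'⟩ :=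
  not (ex (ex (ex (ex ((mul_eq_mul _ _ _ _).and ((ptLe _ _ (Sum.inl (Sum.inl (Sum.inl (Sum.inl f)))) P _ _ _).and
    (ptLe _ _ (Sum.inl (Sum.inl (Sum.inl (Sum.inl f')))) P' _ _ _).not))))))

theorem isGp (a b f : α) (P : β) : Dfn.{u} fun G _ v p => IsGp ⟨v a, v b, v f, p P⟩ := .eq a b

theorem isPt (a b f : α) (P : β) : Dfn.{u} fun G _ v p => IsPt ⟨v a, v b, v f, p P⟩ :=
  (sep a b).and ((ex (.pred P _)).and (ex (all (.imp (.pred P _) (same _ _ _ _)))))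

theorem codeEq (a b f : α) (P : β) (a' b' f' : α) (P' : β) :
    Dfn.{u} fun G _ v p => CodeEq ⟨v a, v b, v f, p P⟩ ⟨v a', v b', v f', p P'⟩ :=
  ((isGp _ _ _ P).and ((isGp _ _ _ P').and (.eq _ _))).or
    ((isGp _ _ f P).not.and ((isGp _ _ f' P').not.and
      (not (ex (ex (ptLt _ _ (Sum.inl (Sum.inl f)) P _ _ (Sum.inl (Sum.inl f')) P' _ _))))))

/-- The variable `(j, i)` is the `i`-th group element of the `j`-th code, matching the indexing of
`φR` in the two notions of interpretation. -/
theorem codeRel {m : ℕ} (R : (actLang edLang).Relations m) :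
    Dfn.{u} (α := Fin m × Fin 3) (β := Fin m) fun G _ v p =>
      CodeRel R fun j => ⟨v (j, 0), v (j, 1), v (j, 2), p j⟩ := by
  match m, R with
  | _, .base EdRel.ed =>
    exact ((isGp _ _ (0, 2) 0).not.and ((isGp _ _ (1, 2) 1).not.and ((isGp _ _ (2, 2) 2).not.and
      (isGp _ _ (3, 2) 3).not))).and (ex (ex
      ((ptLt _ _ (Sum.inl (Sum.inl (0, 2))) 0 _ _ (Sum.inl (Sum.inl (1, 2))) 1 _ _).and
      (ptLt _ _ (Sum.inl (Sum.inl (2, 2))) 2 _ _ (Sum.inl (Sum.inl (3, 2))) 3 _ _))))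
  | _, .mul =>
    exact ((isGp _ _ (0, 2) 0).and ((isGp _ _ (1, 2) 1).and (isGp _ _ (2, 2) 2))).and (.mul _ _ _)
  | _, .ap =>
    exact ((isGp _ _ (0, 2) 0).and ((isGp _ _ (1, 2) 1).not.and (isGp _ _ (2, 2) 2).not)).and
      (ptAp _ _ _ (1, 2) 1 _ _ (2, 2) 2)
  | _, .isPoint => exact (isGp _ _ (0, 2) 0).not
  | _, .isGroup => exact isGp _ _ (0, 2) 0

end Dfn

/-! ### Abstract actions on a chain, and disjointness of supports -/

/-- The properties of the action of `G` on the completion of `L`, for `⟨L, G⟩` in the class `K`. -/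
structure LinAct (X G : Type u) [LinearOrder X] [TopologicalSpace X] [Group G] [MulAction G X] :
    Prop where
  mono : ∀ g : G, StrictMono fun x : X => g • x
  cont : ∀ g : G, Continuous fun x : X => g • x
  faithful : ∀ g : G, (∀ x : X, g • x = x) → g = 1
  exists_supp : ∀ u v : X, u < v → ∃ g : G, g ≠ 1 ∧ ∀ x : X, g • x ≠ x → x ∈ Ioo u v
  trans : ∀ (x y x' y' : X), x < y → x' < y' → ∀ U ∈ 𝓝 x, ∀ V ∈ 𝓝 y, ∀ U' ∈ 𝓝 x', ∀ V' ∈ 𝓝 y',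
    ∃ g : G, (∃ z ∈ U, g • z ∈ U') ∧ ∃ z ∈ V, g • z ∈ V'
  lub : ∀ S : Set X, S.Nonempty → BddAbove S → ∃ x, IsLUB S x
  glb : ∀ S : Set X, S.Nonempty → BddBelow S → ∃ x, IsGLB S x

/-- The support of a group element in an action. -/
def moved (X : Type u) {G : Type u} [Group G] [MulAction G X] (g : G) : Set X := {x | g • x ≠ x}

section moved

variable {X G : Type u} [Group G] [MulAction G X]

theorem moved_inv (g : G) : moved X g⁻¹ = moved X g := by
  ext x
  rw [moved, moved, mem_ofPred_eq, mem_ofPred_eq, ne_eq, ne_eq, inv_smul_eq_iff, eq_comm]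

theorem ne_one_of_mem {g : G} {x : X} (hx : x ∈ moved X g) : g ≠ 1 := by
  rintro rfl
  exact hx (one_smul _ _)

theorem smul_mem_moved {g : G} {x : X} (h : x ∈ moved X g) : g • x ∈ moved X g := by
  simpa [moved] using h

theorem moved_conj (g h : G) {x : X} : x ∈ moved X (g * h * g⁻¹) ↔ g⁻¹ • x ∈ moved X h := by
  simp only [moved, mem_ofPred_eq, mul_smul, ne_eq, ← eq_inv_smul_iff]

/-- The commutator is the product of `a` and the conjugate of `a⁻¹` by `b`, so its support lies in
the support of `a` together with the translate of that support by `b`. -/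
theorem moved_commutator {a b : G} {x : X} (hx : x ∈ moved X (a * b * a⁻¹ * b⁻¹)) :
    x ∈ moved X a ∨ b⁻¹ • x ∈ moved X a := by
  by_contra! h
  refine hx ?_
  have h1 : a⁻¹ • b⁻¹ • x = b⁻¹ • x := by
    have := h.2
    rw [← moved_inv] at this
    simpa [moved] using this
  have h2 : a • x = x := by simpa [moved] using h.1
  rw [mul_smul, mul_smul, mul_smul, h1, smul_inv_smul, h2]

end moved

namespace LinAct

variable {X G : Type u} [LinearOrder X] [TopologicalSpace X] [OrderTopology X] [DenselyOrdered X]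
  [NoMinOrder X] [NoMaxOrder X] [Group G] [MulAction G X]

theorem exists_mem_moved (A : LinAct X G) {g : G} (hg : g ≠ 1) : ∃ x : X, x ∈ moved X g := by
  by_contra! h
  exact hg (A.faithful g fun x => by simpa [moved] using h x)

theorem moved_mem_nhds (A : LinAct X G) {g : G} {x : X} (hx : x ∈ moved X g) : moved X g ∈ 𝓝 x :=
  (isClosed_eq (A.cont g) continuous_id).isOpen_compl.mem_nhds hx

theorem exists_moved_subset (A : LinAct X G) {x : X} {V : Set X} (hV : V ∈ 𝓝 x) :
    ∃ g : G, g ≠ 1 ∧ moved X g ⊆ V := by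
  obtain ⟨l, r, h, hlr⟩ := mem_nhds_iff_exists_Ioo_subset.1 hV
  obtain ⟨g, hg, hs⟩ := A.exists_supp l r (h.1.trans h.2)
  exact ⟨g, hg, fun y hy => hlr (hs y hy)⟩

/-- For `r` strictly between `x` and `g • x`, the interval from `g⁻¹ • r` to `r` is pushed above `r`
by `g`, and further powers only push it higher. -/
theorem exists_nhds_of_lt_smul (A : LinAct X G) {g : G} {x : X} (hx : x < g • x) :
    ∃ V ∈ 𝓝 x, ∀ z ∈ V, ∀ n : ℕ, g ^ (n + 1) • z ∉ V := by
  obtain ⟨r, hxr, hr⟩ := exists_between hx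
  have hl : g⁻¹ • r < x := by
    have := A.mono g⁻¹ hr
    simpa using this
  refine ⟨Ioo (g⁻¹ • r) r, Ioo_mem_nhds hl hxr, fun z hz n hn => ?_⟩
  have h1 : r < g • z := by
    have := A.mono g hz.1
    simpa using this
  have h2 : ∀ n : ℕ, r < g ^ (n + 1) • z := by
    intro n
    induction n with
    | zero => simpa using h1
    | succ n ih =>
      rw [pow_succ', mul_smul]
      exact h1.trans (A.mono g (hz.2.trans ih))
  exact (h2 n).not_gt hn.2

theorem exists_nhds (A : LinAct X G) {g : G} {x : X} (hx : x ∈ moved X g) :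
    ∃ V ∈ 𝓝 x, ∀ z ∈ V, ∀ n : ℕ, g ^ (n + 1) • z ∉ V := by
  rcases lt_or_gt_of_ne hx with h | h
  · have h' : x < g⁻¹ • x := by
      have := A.mono g⁻¹ h
      simpa using this
    obtain ⟨V, hV, hV'⟩ := A.exists_nhds_of_lt_smul h'
    refine ⟨V, hV, fun z hz n hn => hV' _ hn n ?_⟩
    rwa [inv_pow, inv_smul_smul]
  · exact A.exists_nhds_of_lt_smul h

theorem exists_nhds_one (A : LinAct X G) {g : G} {x : X} (hx : x ∈ moved X g) :
    ∃ V ∈ 𝓝 x, ∀ z ∈ V, g • z ∉ V := by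
  obtain ⟨V, hV, h⟩ := A.exists_nhds hx
  exact ⟨V, hV, fun z hz => by simpa using h z hz 0⟩

/-- Each element preserves its own support and fixes the other one pointwise, so the two products
agree at every point; faithfulness finishes. -/
theorem commute_of_disjoint (A : LinAct X G) {f g : G} (h : Disjoint (moved X f) (moved X g)) :
    f * g = g * f := by
  have key : ∀ f g : G, Disjoint (moved X f) (moved X g) → ∀ x ∈ moved X f,
      f • g • x = g • f • x := by
    intro f g h x hx
    have h1 : g • x = x := by simpa [moved] using disjoint_left.1 h hx
    have h2 : g • f • x = f • x := by
      simpa [moved] using disjoint_left.1 h (smul_mem_moved hx)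
    rw [h1, h2]
  rw [← mul_inv_eq_one, mul_inv_rev, ← mul_assoc]
  have h' : ∀ x : X, (f * g) • x = (g * f) • x := by
    intro x
    rw [mul_smul, mul_smul]
    by_cases hf : x ∈ moved X f
    · exact key f g h x hf
    by_cases hg : x ∈ moved X g
    · exact (key g f h.symm x hg).symm
    have h1 : f • x = x := by simpa [moved] using hf
    have h2 : g • x = x := by simpa [moved] using hg
    rw [h1, h2, h1]
  refine A.faithful _ fun x => ?_
  have := h' ((g * f)⁻¹ • x)
  rw [smul_inv_smul, mul_inv_rev] at this
  rw [mul_assoc (f * g), mul_smul, this]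

/-- The group theoretic characterization of disjointness of supports. -/
theorem disj_iff (A : LinAct X G) {f g : G} :
    Disj f g ↔ Disjoint (moved X f) (moved X g) := by
  constructor
  · intro H
    rw [disjoint_left]
    intro x hf hg
    -- At a common point of the supports, take `h` supported where `f` displaces everything, so that
    -- `h` does not commute with `f`, and where no positive power of `g` returns a point, which is
    -- contradicted below.
    obtain ⟨V₁, hV₁, hf1⟩ := A.exists_nhds_one hf
    obtain ⟨V₂, hV₂, hg2⟩ := A.exists_nhds hg
    obtain ⟨h, h1, hs⟩ := A.exists_moved_subset (inter_mem hV₁ hV₂)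
    obtain ⟨z, hz⟩ := A.exists_mem_moved h1
    obtain ⟨f₁, f₂, e₁, e₂, hc1, hc2, he1, he2, he2', hce⟩ := H h <| by
      intro hfh
      have hfz : f • z ∈ moved X h := by
        rw [moved, mem_ofPred_eq, ← mul_smul, ← hfh, mul_smul]
        intro h'
        exact hz (smul_left_cancel f h')
      exact hf1 z (hs hz).1 (hs hfz).1
    have he1' : e₁ = h * f₁ * h⁻¹ * f₁⁻¹ := by
      rw [eq_mul_inv_iff_mul_eq, eq_mul_inv_iff_mul_eq, mul_assoc, he1]
    have he2'' : e₂ = e₁ * f₂ * e₁⁻¹ * f₂⁻¹ := by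
      rw [eq_mul_inv_iff_mul_eq, eq_mul_inv_iff_mul_eq, mul_assoc, he2]
    obtain ⟨y, hy⟩ := A.exists_mem_moved (g := e₂) (fun h => he2' (by simp [h]))
    -- Applying `moved_commutator` twice covers the support of `e₂` by the four translates of `V₂`
    -- by these elements, all of which centralize `g`.
    let w : Fin 4 → G := ![1, f₁, f₂, f₂ * f₁]
    have hw : ∀ i, Commute (w i) g := by
      intro i
      fin_cases i
      exacts [Commute.one_left g, hc1, hc2, Commute.mul_left hc2 hc1]
    have hcov1 : ∀ y ∈ moved X e₁, y ∈ V₂ ∨ f₁⁻¹ • y ∈ V₂ := by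
      intro y hy
      rw [he1'] at hy
      exact (moved_commutator hy).imp (fun h => (hs h).2) (fun h => (hs h).2)
    have hcov : ∀ y ∈ moved X e₂, ∃ i, (w i)⁻¹ • y ∈ V₂ := by
      intro y hy
      rw [he2''] at hy
      rcases moved_commutator hy with h | h <;> rcases hcov1 _ h with h | h
      · exact ⟨0, by simpa [w] using h⟩
      · exact ⟨1, h⟩
      · exact ⟨2, h⟩
      · exact ⟨3, by simpa [w, mul_smul] using h⟩
    have hinv : ∀ n : ℕ, g ^ n • y ∈ moved X e₂ := by
      intro n
      have hc : Commute e₂ (g ^ n) := Commute.pow_right hce n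
      rw [moved, mem_ofPred_eq, ← mul_smul, hc.eq, mul_smul]
      intro h'
      exact hy (smul_left_cancel _ h')
    -- The forward `g`-orbit of `y` stays in the support of `e₂`, since `e₂` commutes with `g`; by
    -- pigeonhole two of its terms lie in the same translate of `V₂`.
    choose i hi using fun n => hcov _ (hinv n)
    obtain ⟨m, n, hmn, himn⟩ : ∃ m n : ℕ, m < n ∧ i m = i n := by
      obtain ⟨m, n, hne, he⟩ := Finite.exists_ne_map_eq_of_infinite i
      rcases lt_or_gt_of_ne hne with h | h
      exacts [⟨m, n, h, he⟩, ⟨n, m, h, he.symm⟩]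
    -- The exponent in `hg2` is shifted by one, so this uses the power `n - m` of `g`; it commutes
    -- with the translating element and sends a point of `V₂` back into `V₂`.
    refine hg2 _ (hi m) (n - m - 1) ?_
    have hc : Commute (g ^ (n - m - 1 + 1)) (w (i m))⁻¹ := ((hw _).pow_right _).symm.inv_right
    rw [← mul_smul, hc.eq, mul_smul, ← mul_smul (g ^ _), ← pow_add, himn]
    have : n - m - 1 + 1 + m = n := by omega
    rw [this]
    exact hi n
  · intro H h hfh
    obtain ⟨x, hxf, hxh⟩ : ∃ x, x ∈ moved X f ∧ x ∈ moved X h := by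
      by_contra! hd
      exact hfh (A.commute_of_disjoint (disjoint_left.2 hd))
    -- Nested choices: `h` moves `V` off itself, `f₁` lives in `V` and in the support of `f`, and
    -- `f₂` lives in the support of `f₁`, on a set `W` that `f₁` moves off itself. All supports
    -- chosen lie in that of `f`, hence away from that of `g`.
    obtain ⟨V, hV, hVh⟩ := A.exists_nhds_one hxh
    obtain ⟨f₁, hf1, hs1⟩ := A.exists_moved_subset (inter_mem hV (A.moved_mem_nhds hxf))
    obtain ⟨z, hz⟩ := A.exists_mem_moved hf1
    obtain ⟨W, hW, hWf⟩ := A.exists_nhds_one hz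
    obtain ⟨f₂, hf2, hs2⟩ := A.exists_moved_subset (inter_mem hW (A.moved_mem_nhds hz))
    obtain ⟨y, hy⟩ := A.exists_mem_moved hf2
    have hyf1 := (hs2 hy).2
    have hd1 : Disjoint (moved X f₁) (moved X g) := H.mono_left fun x hx => (hs1 hx).2
    have hd2 : Disjoint (moved X f₂) (moved X g) := hd1.mono_left fun x hx => (hs2 hx).2
    -- the support of `e₁` meets `V` only in the support of `f₁`
    have hV1 : ∀ x ∈ V, (h * f₁ * h⁻¹ * f₁⁻¹) • x = f₁⁻¹ • x := by
      intro x hx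
      have hx' : f₁⁻¹ • x ∈ V := by
        by_cases hm : x ∈ moved X f₁
        · rw [← moved_inv] at hm
          have := smul_mem_moved hm
          rw [moved_inv] at this
          exact (hs1 this).1
        · rw [← moved_inv] at hm
          have : f₁⁻¹ • x = x := by simpa [moved] using hm
          rwa [this]
      have h1 : h⁻¹ • f₁⁻¹ • x ∉ moved X f₁ := by
        intro hm
        refine hVh _ (hs1 hm).1 ?_
        rwa [smul_inv_smul]
      have h2 : f₁ • h⁻¹ • f₁⁻¹ • x = h⁻¹ • f₁⁻¹ • x := by simpa [moved] using h1
      rw [mul_smul, mul_smul, mul_smul, h2, smul_inv_smul]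
    set e₁ := h * f₁ * h⁻¹ * f₁⁻¹ with he1
    have hk : ∀ x, x ∈ moved X f₂ → e₁ • x = f₁⁻¹ • x := fun x hx => hV1 x (hs1 (hs2 hx).2).1
    -- `f₂` and its conjugate by `e₁` have disjoint supports
    have hne : f₂ ≠ e₁ * f₂ * e₁⁻¹ := by
      intro h'
      have hy' : y ∈ moved X (e₁ * f₂ * e₁⁻¹) := h' ▸ hy
      rw [moved_conj] at hy'
      have h1 := hk _ hy'
      rw [smul_inv_smul] at h1
      have h2 : e₁⁻¹ • y = f₁ • y := by rw [h1, smul_inv_smul, ← h1]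
      rw [h2] at hy'
      exact hWf y (hs2 hy).1 (hs2 hy').1
    -- Both `e₁` and its inverse preserve the support of `f₁`, as `e₁` acts like `f₁⁻¹` there; so
    -- conjugating `f₂` by `e₁` does not leave this support, and the commutator centralizes `g`.
    have hsub : moved X (e₁ * f₂ * e₁⁻¹ * f₂⁻¹) ⊆ moved X f₁ := by
      have hmem : ∀ x, x ∈ moved X f₁ → e₁⁻¹ • x ∈ moved X f₁ ∧ e₁ • x ∈ moved X f₁ := by
        intro x hx
        have h1 : e₁ • f₁ • x = x := by
          rw [hV1 _ (hs1 (smul_mem_moved hx)).1, inv_smul_smul]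
        refine ⟨?_, ?_⟩
        · rw [← h1, inv_smul_smul]
          exact smul_mem_moved hx
        · rw [hV1 _ (hs1 hx).1]
          rw [← moved_inv] at hx ⊢
          exact smul_mem_moved hx
      intro x hx
      by_contra hx1
      have h2 : x ∉ moved X f₂ := fun h => hx1 (hs2 h).2
      have h3 : f₂⁻¹ • x = x := by
        rw [← moved_inv] at h2
        simpa [moved] using h2
      have h4 : e₁⁻¹ • x ∉ moved X f₂ := by
        intro h
        refine hx1 ?_
        have := (hmem _ (hs2 h).2).2
        rwa [smul_inv_smul] at this
      have h5 : f₂ • e₁⁻¹ • x = e₁⁻¹ • x := by simpa [moved] using h4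
      refine hx ?_
      rw [mul_smul, h3, mul_smul, mul_smul, h5, smul_inv_smul]
    refine ⟨f₁, f₂, e₁, e₁ * f₂ * e₁⁻¹ * f₂⁻¹, A.commute_of_disjoint hd1,
      A.commute_of_disjoint hd2, by rw [he1]; group, by group, ?_,
      A.commute_of_disjoint (hd1.mono_left hsub)⟩
    rw [mul_eq_left, mul_inv_eq_one]
    exact fun h' => hne h'.symm

/-! ### Separated elements and their directions -/

variable (X) in
/-- The supports of `a` and `b` are nonempty, and that of `a` lies to the left of that of `b`. -/
def Before (a b : G) : Prop :=
  (moved X a).Nonempty ∧ (moved X b).Nonempty ∧ ∀ x ∈ moved X a, ∀ y ∈ moved X b, x < y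

/-- The witness in `Touch` is forced to be the conjugate of `a` by `g`, whose support is the image
under `g` of the support of `a`. -/
theorem touch_iff (A : LinAct X G) {g a b : G} :
    Touch g a b ↔ ∃ x ∈ moved X a, g • x ∈ moved X b := by
  have h : Touch g a b ↔ ¬ Disj (g * a * g⁻¹) b := by
    constructor
    · rintro ⟨x, hx, h⟩
      rwa [hx, mul_inv_cancel_right]
    · intro h
      exact ⟨_, by group, h⟩
  rw [h, A.disj_iff, not_disjoint_iff]
  constructor
  · rintro ⟨x, hx, hb⟩
    rw [moved_conj] at hx
    exact ⟨_, hx, by rwa [smul_inv_smul]⟩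
  · rintro ⟨x, hx, hb⟩
    exact ⟨_, by rwa [moved_conj, inv_smul_smul], hb⟩

theorem Before.not_touch (A : LinAct X G) {a b c d g : G} (h : Before X a b) (h' : Before X d c) :
    ¬ (Touch g a c ∧ Touch g b d) := by
  rw [A.touch_iff, A.touch_iff]
  rintro ⟨⟨x, hx, hx'⟩, y, hy, hy'⟩
  exact (A.mono g (h.2.2 x hx y hy)).not_gt (h'.2.2 _ hy' _ hx')

/-- This is 2-interval-transitivity, with the supports serving as neighbourhoods of the given
points. -/
theorem exists_touch (A : LinAct X G) {a b c d : G} {x y x' y' : X} (hx : x ∈ moved X a)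
    (hy : y ∈ moved X b) (hx' : x' ∈ moved X c) (hy' : y' ∈ moved X d) (h : x < y) (h' : x' < y') :
    ∃ g, Touch g a c ∧ Touch g b d := by
  obtain ⟨g, h1, h2⟩ := A.trans x y x' y' h h' _ (A.moved_mem_nhds hx) _ (A.moved_mem_nhds hy) _
    (A.moved_mem_nhds hx') _ (A.moved_mem_nhds hy')
  exact ⟨g, A.touch_iff.2 h1, A.touch_iff.2 h2⟩

theorem nonempty_moved (A : LinAct X G) {a : G} : (moved X a).Nonempty ↔ ¬ a * a = a := by
  rw [mul_eq_left]
  exact ⟨fun ⟨x, hx⟩ => ne_one_of_mem hx, fun h => A.exists_mem_moved h⟩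

/-- Supports are open, so `y` can be lowered slightly; this covers the case where the two points
coincide. -/
theorem exists_lt_of_not_lt (A : LinAct X G) {a b : G} {x y : X} (hx : x ∈ moved X a)
    (hy : y ∈ moved X b) (h : y ≤ x) : ∃ x ∈ moved X a, ∃ y ∈ moved X b, y < x := by
  obtain ⟨l, hl, hl'⟩ := exists_Ioc_subset_of_mem_nhds (A.moved_mem_nhds hy) (exists_lt y)
  obtain ⟨z, hz, hz'⟩ := exists_between hl
  exact ⟨x, hx, z, hl' ⟨hz, hz'.le⟩, hz'.trans_le h⟩

/-- If neither support lies to the left of the other, there are pairs of points from them in both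
orders, and transitivity maps a pair in one order close to a pair in the other, interchanging the
supports. A monotone map cannot do this to separated supports. -/
theorem sep_iff (A : LinAct X G) {a b : G} : Sep a b ↔ Before X a b ∨ Before X b a := by
  rw [Sep, ← A.nonempty_moved, ← A.nonempty_moved]
  constructor
  · rintro ⟨ha, hb, h⟩
    by_contra! h'
    simp only [Before, ha, hb, true_and] at h'
    push Not at h'
    obtain ⟨⟨x, hx, y, hy, hxy⟩, y', hy', x', hx', hyx'⟩ := h'
    obtain ⟨x, hx, y, hy, hxy⟩ := A.exists_lt_of_not_lt hx hy hxy
    obtain ⟨y', hy', x', hx', hyx'⟩ := A.exists_lt_of_not_lt hy' hx' hyx'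
    obtain ⟨g, h1, h2⟩ := A.exists_touch hx' hy' hy hx hyx' hxy
    exact h ⟨g, h1, h2⟩
  · rintro (h | h)
    · exact ⟨h.1, h.2.1, fun ⟨g, hg⟩ => h.not_touch A h hg⟩
    · exact ⟨h.2.1, h.1, fun ⟨g, hg⟩ => h.not_touch A h hg.symm⟩

theorem Before.asymm {a b : G} (h : Before X a b) : ¬ Before X b a := by
  obtain ⟨⟨x, hx⟩, ⟨y, hy⟩, h⟩ := h
  exact fun h' => (h x hx y hy).not_gt (h'.2.2 y hy x hx)

/-- Pairs with the same direction can be matched by transitivity, and a monotone map cannot match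
pairs of opposite directions. -/
theorem same_iff (A : LinAct X G) {a b c d : G} :
    Same a b c d ↔ (Before X a b ∧ Before X c d) ∨ (Before X b a ∧ Before X d c) := by
  rw [Same, A.sep_iff, A.sep_iff]
  have key : ∀ {a b c d : G}, Before X a b → Before X c d → ∃ g, Touch g a c ∧ Touch g b d := by
    rintro a b c d ⟨⟨x, hx⟩, ⟨y, hy⟩, h⟩ ⟨⟨x', hx'⟩, ⟨y', hy'⟩, h'⟩
    exact A.exists_touch hx hy hx' hy' (h x hx y hy) (h' x' hx' y' hy')
  constructor
  · rintro ⟨h1 | h1, h2 | h2, g, hg⟩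
    · exact .inl ⟨h1, h2⟩
    · exact (h1.not_touch A h2 hg).elim
    · exact (h1.not_touch A h2 hg.symm).elim
    · exact .inr ⟨h1, h2⟩
  · rintro (⟨h1, h2⟩ | ⟨h1, h2⟩)
    · exact ⟨.inl h1, .inl h2, key h1 h2⟩
    · obtain ⟨g, hg⟩ := key h1 h2
      exact ⟨.inr h1, .inr h2, g, hg.symm⟩

end LinAct

/-! ### Decoding points -/

/-- The union of the supports of the elements of the set parameter of a code. -/
def Code.union (X : Type u) {G : Type u} [Group G] [MulAction G X] (x : Code G) : Set X :=
  {z | ∃ f, x.P f ∧ z ∈ moved X f}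

namespace LinAct

variable {X G : Type u} [LinearOrder X] [TopologicalSpace X] [OrderTopology X] [DenselyOrdered X]
  [NoMinOrder X] [NoMaxOrder X] [Group G] [MulAction G X]

/-- The point `p` is coded by `x`. -/
def PtOf (x : Code G) (p : X) : Prop :=
  (Before X x.a x.b ∧ IsGLB (x.union X) p) ∨ (Before X x.b x.a ∧ IsLUB (x.union X) p)

theorem Before.same (A : LinAct X G) {a b c d : G} (h : Before X a b) :
    Same a b c d ↔ Before X c d := by
  rw [A.same_iff]
  simp [h, h.asymm]

theorem Before.same' (A : LinAct X G) {a b c d : G} (h : Before X b a) :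
    Same a b c d ↔ Before X d c := by
  rw [A.same_iff]
  simp [h, h.asymm]

theorem not_sep_self (A : LinAct X G) (a : G) : ¬ Sep a a := by
  rw [A.sep_iff]
  rintro (h | h) <;> exact h.asymm h

theorem not_isGp (A : LinAct X G) {x : Code G} (h : IsPt x) : ¬ IsGp x := by
  intro h'
  have := h.1
  rw [h'] at this
  exact A.not_sep_self _ this

theorem exists_gt_moved (A : LinAct X G) {f : G} {z : X} (hz : z ∈ moved X f) :
    ∃ w ∈ moved X f, z < w := by
  obtain ⟨r, hr, hr'⟩ := exists_Ico_subset_of_mem_nhds (A.moved_mem_nhds hz) (exists_gt z)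
  obtain ⟨w, h1, h2⟩ := exists_between hr
  exact ⟨w, hr' ⟨h1.le, h2⟩, h1⟩

theorem exists_lt_moved (A : LinAct X G) {f : G} {z : X} (hz : z ∈ moved X f) :
    ∃ w ∈ moved X f, w < z := by
  obtain ⟨l, hl, hl'⟩ := exists_Ioc_subset_of_mem_nhds (A.moved_mem_nhds hz) (exists_lt z)
  obtain ⟨w, h1, h2⟩ := exists_between hl
  exact ⟨w, hl' ⟨h1, h2.le⟩, h2⟩

theorem exists_moved_Ioo (A : LinAct X G) {p q : X} (h : p < q) :
    ∃ c : G, (moved X c).Nonempty ∧ moved X c ⊆ Ioo p q := by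
  obtain ⟨g, hg, hs⟩ := A.exists_supp p q h
  exact ⟨g, A.exists_mem_moved hg, hs⟩

/-- The weak bound gives strict separation because an open support has no greatest element. -/
theorem before_iff_of_isLUB (A : LinAct X G) {x : Code G} {p : X} (hp : IsLUB (x.union X) p)
    (hP : ∃ f, x.P f) (hne : ∀ f, x.P f → (moved X f).Nonempty) (c : G) :
    (∀ f, x.P f → Before X f c) ↔ (moved X c).Nonempty ∧ ∀ z ∈ moved X c, p ≤ z := by
  constructor
  · intro h
    obtain ⟨f, hf⟩ := hP
    exact ⟨(h f hf).2.1, fun z hz => hp.2 fun w ⟨f, hf, hw⟩ => ((h f hf).2.2 w hw z hz).le⟩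
  · intro h f hf
    refine ⟨hne f hf, h.1, fun z hz w hw => ?_⟩
    obtain ⟨z', hz', hzz⟩ := A.exists_gt_moved hz
    exact hzz.trans_le ((hp.1 ⟨f, hf, hz'⟩).trans (h.2 w hw))

theorem before_iff_of_isGLB (A : LinAct X G) {x : Code G} {p : X} (hp : IsGLB (x.union X) p)
    (hP : ∃ f, x.P f) (hne : ∀ f, x.P f → (moved X f).Nonempty) (c : G) :
    (∀ f, x.P f → Before X c f) ↔ (moved X c).Nonempty ∧ ∀ z ∈ moved X c, z ≤ p := by
  constructor
  · intro h
    obtain ⟨f, hf⟩ := hP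
    exact ⟨(h f hf).1, fun z hz => hp.2 fun w ⟨f, hf, hw⟩ => ((h f hf).2.2 z hz w hw).le⟩
  · intro h f hf
    refine ⟨h.1, hne f hf, fun z hz w hw => ?_⟩
    obtain ⟨w', hw', hww⟩ := A.exists_lt_moved hw
    exact (h.2 z hz).trans_lt ((hp.1 ⟨f, hf, hw'⟩).trans_lt hww)

/-- A support reaching below `p` at `z` fails to come after a small support placed between `z` and
`p`. Thus the supports above `p` are determined by those below it, so a code can be read in either
orientation. -/
theorem before_all_iff (A : LinAct X G) (p : X) (c : G) :
    (∀ c', (moved X c').Nonempty ∧ (∀ z ∈ moved X c', z ≤ p) → Before X c' c) ↔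
      (moved X c).Nonempty ∧ ∀ z ∈ moved X c, p ≤ z := by
  constructor
  · intro h
    obtain ⟨l, hl⟩ := exists_lt p
    obtain ⟨c', hc, hs⟩ := A.exists_moved_Ioo hl
    refine ⟨(h c' ⟨hc, fun z hz => (hs hz).2.le⟩).2.1, fun z hz => ?_⟩
    by_contra! hzp
    obtain ⟨c', hc, hs⟩ := A.exists_moved_Ioo hzp
    obtain ⟨w, hw⟩ := hc
    exact ((h c' ⟨⟨w, hw⟩, fun z hz => (hs hz).2.le⟩).2.2 w hw z hz).not_gt (hs hw).1
  · rintro ⟨hc, h⟩ c' ⟨hc', h'⟩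
    refine ⟨hc', hc, fun z hz w hw => ?_⟩
    obtain ⟨z', hz', hzz⟩ := A.exists_gt_moved hz
    exact hzz.trans_le ((h' _ hz').trans (h w hw))

theorem all_before_iff (A : LinAct X G) (p : X) (c : G) :
    (∀ c', (moved X c').Nonempty ∧ (∀ z ∈ moved X c', p ≤ z) → Before X c c') ↔
      (moved X c).Nonempty ∧ ∀ z ∈ moved X c, z ≤ p := by
  constructor
  · intro h
    obtain ⟨r, hr⟩ := exists_gt p
    obtain ⟨c', hc, hs⟩ := A.exists_moved_Ioo hr
    refine ⟨(h c' ⟨hc, fun z hz => (hs hz).1.le⟩).1, fun z hz => ?_⟩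
    by_contra! hzp
    obtain ⟨c', hc, hs⟩ := A.exists_moved_Ioo hzp
    obtain ⟨w, hw⟩ := hc
    exact ((h c' ⟨⟨w, hw⟩, fun z hz => (hs hz).1.le⟩).2.2 z hz w hw).not_gt (hs hw).2
  · rintro ⟨hc, h⟩ c' ⟨hc', h'⟩
    refine ⟨hc, hc', fun z hz w hw => ?_⟩
    obtain ⟨z', hz', hzz⟩ := A.exists_gt_moved hz
    exact hzz.trans_le ((h _ hz').trans (h' w hw))

theorem nonempty_of_isPt (A : LinAct X G) {x : Code G} (hx : IsPt x) :
    ∀ f, x.P f → (moved X f).Nonempty := by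
  obtain ⟨-, -, c, hc⟩ := hx
  intro f hf
  rcases A.same_iff.1 (hc f hf) with h | h
  exacts [h.2.2.1, h.2.1]

/-- The element `c` in `IsPt` bounds the union of the supports on the required side, so completeness
provides the infimum or supremum. -/
theorem exists_ptOf (A : LinAct X G) {x : Code G} (hx : IsPt x) : ∃ p : X, PtOf x p := by
  have hne := A.nonempty_of_isPt hx
  obtain ⟨hs, ⟨f, hf⟩, c, hc⟩ := hx
  have hU : (x.union X).Nonempty := by
    obtain ⟨z, hz⟩ := hne f hf
    exact ⟨z, f, hf, hz⟩
  rcases A.sep_iff.1 hs with h | h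
  · simp only [h.same A] at hc
    obtain ⟨w, hw⟩ := (hc f hf).1
    obtain ⟨p, hp⟩ := A.glb _ hU ⟨w, fun z ⟨f, hf, hz⟩ => ((hc f hf).2.2 w hw z hz).le⟩
    exact ⟨p, .inl ⟨h, hp⟩⟩
  · simp only [h.same' A] at hc
    obtain ⟨w, hw⟩ := (hc f hf).2.1
    obtain ⟨p, hp⟩ := A.lub _ hU ⟨w, fun z ⟨f, hf, hz⟩ => ((hc f hf).2.2 z hz w hw).le⟩
    exact ⟨p, .inr ⟨h, hp⟩⟩

/-- When `s`, `t` reverse the orientation of the code, the point is a supremum in their order and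
lying beyond `P` suffices. When they agree with it, the point is an infimum, and `c` has to lie
beyond everything that precedes `P`. -/
theorem ptLe_iff (A : LinAct X G) {x : Code G} {p : X} (hx : IsPt x) (hp : PtOf x p) (s t c : G) :
    PtLe x s t c ↔ (Before X s t ∧ (moved X c).Nonempty ∧ ∀ z ∈ moved X c, p ≤ z) ∨
      (Before X t s ∧ (moved X c).Nonempty ∧ ∀ z ∈ moved X c, z ≤ p) := by
  have hne := A.nonempty_of_isPt hx
  have hP := hx.2.1
  unfold PtLe
  by_cases hst : Before X s t
  · simp only [hst.same A, hst, hst.asymm, true_and, false_and, or_false]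
    rcases hp with ⟨h, hp⟩ | ⟨h, hp⟩
    · simp only [h.same A, h.same' A, hst, hst.asymm, true_and, false_and, or_false,
        A.before_iff_of_isGLB hp hP hne]
      exact A.before_all_iff p c
    · simp only [h.same A, h.same' A, hst, hst.asymm, true_and, false_and, false_or,
        A.before_iff_of_isLUB hp hP hne]
  by_cases hts : Before X t s
  · simp only [hts.same' A, hts, hst, true_and, false_and, false_or]
    rcases hp with ⟨h, hp⟩ | ⟨h, hp⟩
    · simp only [h.same A, h.same' A, hst, hts, true_and, false_and, false_or,
        A.before_iff_of_isGLB hp hP hne]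
    · simp only [h.same A, h.same' A, hst, hts, true_and, false_and, or_false,
        A.before_iff_of_isLUB hp hP hne]
      exact A.all_before_iff p c
  · simp [A.same_iff, hst, hts]

/-- For the converse, `c` is supported strictly between `g • p` and `q`, and `c'` is its conjugate
back by `g`. Taking `g = 1` gives the order of coded points; failure for all `s`, `t` gives `g • p =
q`, because both orientations occur. -/
theorem ptLe_smul_iff (A : LinAct X G) {x y : Code G} {p q : X} (hx : IsPt x) (hp : PtOf x p)
    (hy : IsPt y) (hq : PtOf y q) (g s t : G) :
    (∃ c c', g * c' = c * g ∧ PtLe x s t c' ∧ ¬ PtLe y s t c) ↔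
      (Before X s t ∧ g • p < q) ∨ (Before X t s ∧ q < g • p) := by
  simp only [A.ptLe_iff hx hp, A.ptLe_iff hy hq]
  constructor
  · rintro ⟨c, c', hc, h, h'⟩
    obtain rfl : c = g * c' * g⁻¹ := by rw [hc, mul_inv_cancel_right]
    have key : (moved X c').Nonempty → (moved X (g * c' * g⁻¹)).Nonempty := by
      rintro ⟨z, hz⟩
      exact ⟨g • z, by rwa [moved_conj, inv_smul_smul]⟩
    rcases h with ⟨h, h1, h2⟩ | ⟨h, h1, h2⟩
    · simp only [h, h.asymm, true_and, false_and, or_false, not_and, not_forall, not_le] at h' ⊢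
      obtain ⟨z, hz, hzq⟩ := h' (key h1)
      refine lt_of_le_of_lt ?_ hzq
      have := (A.mono g).monotone (h2 _ ((moved_conj g c').1 hz))
      simpa using this
    · simp only [h, h.asymm, true_and, false_and, false_or, not_and, not_forall, not_le] at h' ⊢
      obtain ⟨z, hz, hzq⟩ := h' (key h1)
      refine lt_of_lt_of_le hzq ?_
      have := (A.mono g).monotone (h2 _ ((moved_conj g c').1 hz))
      simpa using this
  · have key : ∀ {p q : X}, p < q → ∃ c c' : G, g * c' = c * g ∧ (moved X c').Nonempty ∧
        (moved X c).Nonempty ∧ moved X c ⊆ Ioo p q ∧ ∀ z ∈ moved X c', g • z ∈ moved X c := by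
      intro p q h
      obtain ⟨c, ⟨z, hz⟩, hs⟩ := A.exists_moved_Ioo h
      have hc : c = g * (g⁻¹ * c * g) * g⁻¹ := by group
      refine ⟨c, g⁻¹ * c * g, by group, ⟨g⁻¹ • z, ?_⟩, ⟨z, hz⟩, hs, fun z hz => ?_⟩
      · rw [hc, moved_conj] at hz
        exact hz
      · rwa [hc, moved_conj, inv_smul_smul]
    rintro (⟨h, hlt⟩ | ⟨h, hlt⟩)
    · obtain ⟨c, c', hc, hn', hn, hs, hm⟩ := key hlt
      refine ⟨c, c', hc, ?_⟩
      simp only [h, h.asymm, true_and, false_and, or_false, not_and, not_forall, not_le]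
      refine ⟨⟨hn', fun z hz => ?_⟩, fun _ => ?_⟩
      · exact (A.mono g).le_iff_le.1 (hs (hm z hz)).1.le
      · obtain ⟨z, hz⟩ := hn
        exact ⟨z, hz, (hs hz).2⟩
    · obtain ⟨c, c', hc, hn', hn, hs, hm⟩ := key hlt
      refine ⟨c, c', hc, ?_⟩
      simp only [h, h.asymm, true_and, false_and, false_or, not_and, not_forall, not_le]
      refine ⟨⟨hn', fun z hz => ?_⟩, fun _ => ?_⟩
      · exact (A.mono g).le_iff_le.1 (hs (hm z hz)).2.le
      · obtain ⟨z, hz⟩ := hn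
        exact ⟨z, hz, (hs hz).1⟩

theorem ptLt_iff (A : LinAct X G) {x y : Code G} {p q : X} (hx : IsPt x) (hp : PtOf x p)
    (hy : IsPt y) (hq : PtOf y q) (s t : G) :
    PtLt x y s t ↔ (Before X s t ∧ p < q) ∨ (Before X t s ∧ q < p) := by
  simpa [PtLt] using A.ptLe_smul_iff hx hp hy hq 1 s t

theorem exists_before (A : LinAct X G) (p : X) : ∃ s t : G, Before X s t := by
  obtain ⟨q, hq⟩ := exists_gt p
  obtain ⟨r, hr⟩ := exists_gt q
  obtain ⟨s, hs, hs'⟩ := A.exists_moved_Ioo hq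
  obtain ⟨t, ht, ht'⟩ := A.exists_moved_Ioo hr
  exact ⟨s, t, hs, ht, fun x hx y hy => (hs' hx).2.trans (ht' hy).1⟩

theorem not_exists_before_iff (A : LinAct X G) (p q : X) :
    (¬ ∃ s t : G, (Before X s t ∧ p < q) ∨ (Before X t s ∧ q < p)) ↔ p = q := by
  obtain ⟨s, t, h⟩ := A.exists_before p
  constructor
  · intro H
    by_contra! hne
    rcases lt_or_gt_of_ne hne with h' | h'
    · exact H ⟨s, t, .inl ⟨h, h'⟩⟩
    · exact H ⟨t, s, .inr ⟨h, h'⟩⟩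
  · rintro rfl
    simp

theorem ptAp_iff (A : LinAct X G) {x y : Code G} {p q : X} (hx : IsPt x) (hp : PtOf x p)
    (hy : IsPt y) (hq : PtOf y q) (g : G) : PtAp g x y ↔ g • p = q := by
  rw [PtAp, ← A.not_exists_before_iff]
  simp only [A.ptLe_smul_iff hx hp hy hq]

theorem ptEq_iff (A : LinAct X G) {x y : Code G} {p q : X} (hx : IsPt x) (hp : PtOf x p)
    (hy : IsPt y) (hq : PtOf y q) : (¬ ∃ s t, PtLt x y s t) ↔ p = q := by
  rw [← A.not_exists_before_iff]
  simp only [A.ptLt_iff hx hp hy hq]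

/-! ### Decoding -/

variable {Y : Type u} [LT Y] [MulAction G Y] {ι : Y → X}

/-- The element `z` of the structure of the action of `G` on the subset `Y` of `X` is coded
by `x`. -/
def Val (ι : Y → X) (x : Code G) : Act Y G → Prop
  | .inl y => IsPt x ∧ PtOf x (ι y)
  | .inr g => IsGp x ∧ x.f = g

theorem codeEq_iff (A : LinAct X G) (hι : ι.Injective) {x x' : Code G} {z z' : Act Y G}
    (h : Val ι x z) (h' : Val ι x' z') : CodeEq x x' ↔ z = z' := by
  unfold CodeEq
  rcases z with y | g <;> rcases z' with y' | g'
  · simp only [A.not_isGp h.1, A.not_isGp h'.1, false_and, false_or, not_false_eq_true, true_and,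
      A.ptEq_iff h.1 h.2 h'.1 h'.2, Sum.inl.injEq]
    exact hι.eq_iff
  · simp [A.not_isGp h.1, h'.1]
  · simp [A.not_isGp h'.1, h.1]
  · simp [h.1, h'.1, h.2, h'.2]

theorem isGp_iff (A : LinAct X G) {x : Code G} {z : Act Y G} (h : Val ι x z) :
    IsGp x ↔ ∃ g : G, z = .inr g := by
  rcases z with y | g
  · simp [A.not_isGp h.1]
  · simp [h.1]

theorem not_isGp_iff (A : LinAct X G) {x : Code G} {z : Act Y G} (h : Val ι x z) :
    ¬ IsGp x ↔ ∃ y : Y, z = .inl y := by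
  rcases z with y | g
  · simp [A.not_isGp h.1]
  · simp [h.1]

/-- For the equal direction relation, one pair `s`, `t` serves both comparisons: reversing it
reverses both, so only their agreement is recorded. -/
theorem codeRel_iff (A : LinAct X G) (hι : ∀ y y', ι y < ι y' ↔ y < y') (hinj : ι.Injective)
    (hs : ∀ (g : G) y, ι (g • y) = g • ι y) {m : ℕ} (R : (actLang edLang).Relations m)
    {x : Fin m → Code G} {z : Fin m → Act Y G} (h : ∀ j, Val ι (x j) (z j)) :
    Structure.RelMap R z ↔ CodeRel R x := by
  match m, R with
  | _, .base EdRel.ed =>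
    change (∃ y : Fin 4 → Y, z = (fun j => Sum.inl (y j)) ∧ Ed (y 0) (y 1) (y 2) (y 3)) ↔
      (¬ IsGp (x 0) ∧ ¬ IsGp (x 1) ∧ ¬ IsGp (x 2) ∧ ¬ IsGp (x 3)) ∧
      ∃ s t, PtLt (x 0) (x 1) s t ∧ PtLt (x 2) (x 3) s t
    have key : ∀ y : Fin 4 → Y, z = (fun j => Sum.inl (y j)) → (Ed (y 0) (y 1) (y 2) (y 3) ↔
        ∃ s t, PtLt (x 0) (x 1) s t ∧ PtLt (x 2) (x 3) s t) := by
      rintro y rfl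
      simp only [A.ptLt_iff (h _).1 (h _).2 (h _).1 (h _).2, Ed, hι, gt_iff_lt]
      constructor
      · obtain ⟨s, t, hst⟩ := A.exists_before (ι (y 0))
        rintro (⟨h1, h2⟩ | ⟨h1, h2⟩)
        · exact ⟨s, t, .inl ⟨hst, h1⟩, .inl ⟨hst, h2⟩⟩
        · exact ⟨t, s, .inr ⟨hst, h1⟩, .inr ⟨hst, h2⟩⟩
      · rintro ⟨s, t, ⟨h1, h2⟩ | ⟨h1, h2⟩, ⟨h3, h4⟩ | ⟨h3, h4⟩⟩
        · exact .inl ⟨h2, h4⟩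
        · exact (h1.asymm h3).elim
        · exact (h1.asymm h3).elim
        · exact .inr ⟨h2, h4⟩
    constructor
    · rintro ⟨y, rfl, hy⟩
      exact ⟨⟨A.not_isGp (h 0).1, A.not_isGp (h 1).1, A.not_isGp (h 2).1, A.not_isGp (h 3).1⟩,
        (key y rfl).1 hy⟩
    · rintro ⟨⟨h0, h1, h2, h3⟩, H⟩
      have : ∀ j, ∃ y : Y, z j = .inl y := by
        intro j
        refine (A.not_isGp_iff (h j)).1 ?_
        fin_cases j
        exacts [h0, h1, h2, h3]
      choose y hy using this
      exact ⟨y, funext hy, (key y (funext hy)).2 H⟩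
  | _, .mul =>
    change (∃ g h : G, z = ![Sum.inr g, Sum.inr h, Sum.inr (g * h)]) ↔
      (IsGp (x 0) ∧ IsGp (x 1) ∧ IsGp (x 2)) ∧ (x 0).f * (x 1).f = (x 2).f
    constructor
    · rintro ⟨g, k, rfl⟩
      refine ⟨⟨(h 0).1, (h 1).1, (h 2).1⟩, ?_⟩
      rw [(h 0).2, (h 1).2, (h 2).2]
    · rintro ⟨⟨h0, h1, h2⟩, H⟩
      obtain ⟨g, hg⟩ := (A.isGp_iff (h 0)).1 h0
      obtain ⟨k, hk⟩ := (A.isGp_iff (h 1)).1 h1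
      obtain ⟨l, hl⟩ := (A.isGp_iff (h 2)).1 h2
      have e0 := h 0
      have e1 := h 1
      have e2 := h 2
      rw [hg] at e0
      rw [hk] at e1
      rw [hl] at e2
      rw [e0.2, e1.2, e2.2] at H
      refine ⟨g, k, funext fun j => ?_⟩
      fin_cases j
      exacts [hg, hk, hl.trans (congrArg _ H.symm)]
  | _, .ap =>
    change (∃ (g : G) (a : Y), z = ![Sum.inr g, Sum.inl a, Sum.inl (g • a)]) ↔
      (IsGp (x 0) ∧ ¬ IsGp (x 1) ∧ ¬ IsGp (x 2)) ∧ PtAp (x 0).f (x 1) (x 2)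
    constructor
    · rintro ⟨g, k, rfl⟩
      refine ⟨⟨(h 0).1, A.not_isGp (h 1).1, A.not_isGp (h 2).1⟩, ?_⟩
      rw [(h 0).2]
      exact (A.ptAp_iff (h 1).1 (h 1).2 (h 2).1 (h 2).2 g).2 (hs g k).symm
    · rintro ⟨⟨h0, h1, h2⟩, H⟩
      obtain ⟨g, hg⟩ := (A.isGp_iff (h 0)).1 h0
      obtain ⟨k, hk⟩ := (A.not_isGp_iff (h 1)).1 h1
      obtain ⟨l, hl⟩ := (A.not_isGp_iff (h 2)).1 h2
      have e0 := h 0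
      have e1 := h 1
      have e2 := h 2
      rw [hg] at e0
      rw [hk] at e1
      rw [hl] at e2
      rw [e0.2, A.ptAp_iff e1.1 e1.2 e2.1 e2.2, ← hs, hinj.eq_iff] at H
      refine ⟨g, k, funext fun j => ?_⟩
      fin_cases j
      exacts [hg, hk, hl.trans (congrArg _ H.symm)]
  | _, .isPoint =>
    change (∃ y : Y, z = ![Sum.inl y]) ↔ ¬ IsGp (x 0)
    rw [A.not_isGp_iff (h 0)]
    refine exists_congr fun y => ⟨fun H => congrFun H 0, fun H => funext fun j => ?_⟩
    fin_cases j
    exact H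
  | _, .isGroup =>
    change (∃ g : G, z = ![Sum.inr g]) ↔ IsGp (x 0)
    rw [A.isGp_iff (h 0)]
    refine exists_congr fun y => ⟨fun H => congrFun H 0, fun H => funext fun j => ?_⟩
    fin_cases j
    exact H

/-- If all points of `Y` and all elements of `G` have codes, then the structure of the action of `G`
on `Y` is interpreted in `G`. -/
theorem exists_decoding (A : LinAct X G) (hι : ∀ y y', ι y < ι y' ↔ y < y') (hinj : ι.Injective)
    (hs : ∀ (g : G) y, ι (g • y) = g • ι y) {T : Type v} {code : T → Code G} {U : T → Prop}
    (hU : ∀ t, U t ↔ IsGp (code t) ∨ IsPt (code t))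
    (hval : ∀ t, IsPt (code t) → ∃ y, PtOf (code t) (ι y))
    (hpt : ∀ y, ∃ t, IsPt (code t) ∧ PtOf (code t) (ι y))
    (hgp : ∀ g, ∃ t, IsGp (code t) ∧ (code t).f = g) :
    ∃ μ : {t // U t} → Act Y G, Function.Surjective μ ∧
      (∀ a b, μ a = μ b ↔ CodeEq (code a.1) (code b.1)) ∧
      (∀ (m : ℕ) (R : (actLang edLang).Relations m) (a : Fin m → {t // U t}),
        Structure.RelMap R (fun j => μ (a j)) ↔ CodeRel R fun j => code (a j).1) ∧
      ∀ t b, (IsGp (code t) ∧ (code t).f = b) ↔ ∃ h : U t, μ ⟨t, h⟩ = .inr b := by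
  have : ∀ t : {t // U t}, ∃ z : Act Y G, Val ι (code t.1) z := by
    rintro ⟨t, ht⟩
    rcases (hU t).1 ht with h | h
    · exact ⟨.inr _, h, rfl⟩
    · obtain ⟨y, hy⟩ := hval t h
      exact ⟨.inl y, h, hy⟩
  choose μ hμ using this
  -- A code has only one value: equality of values is `CodeEq`, which holds between a valid code and
  -- itself.
  have huniq : ∀ t (h : U t) z, Val ι (code t) z → μ ⟨t, h⟩ = z := by
    intro t h z hz
    have h1 := hμ ⟨t, h⟩
    rw [← A.codeEq_iff hinj h1 hz]
    exact (A.codeEq_iff hinj h1 h1).2 rfl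
  refine ⟨μ, ?_, fun a b => (A.codeEq_iff hinj (hμ a) (hμ b)).symm,
    fun m R a => A.codeRel_iff hι hinj hs R fun j => hμ (a j), fun t b => ⟨fun h => ?_, ?_⟩⟩
  · rintro (y | g)
    · obtain ⟨t, h1, h2⟩ := hpt y
      exact ⟨⟨t, (hU t).2 (.inr h1)⟩, huniq _ _ _ ⟨h1, h2⟩⟩
    · obtain ⟨t, h1, h2⟩ := hgp g
      exact ⟨⟨t, (hU t).2 (.inl h1)⟩, huniq _ _ _ ⟨h1, h2⟩⟩
  · exact ⟨(hU t).2 (.inl h.1), huniq _ _ _ h⟩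
  · rintro ⟨h, hb⟩
    have := hμ ⟨t, h⟩
    rwa [hb] at this


/-! ### Existence of codes for points -/

variable {X G : Type u} [LinearOrder X] [TopologicalSpace X] [OrderTopology X] [DenselyOrdered X]
  [NoMinOrder X] [NoMaxOrder X] [Group G] [MulAction G X]

theorem isPt_of_isGLB (A : LinAct X G) {x : Code G} {p : X} (h : Before X x.a x.b)
    (hp : IsGLB (x.union X) p) (hP : ∃ f, x.P f) (hne : ∀ f, x.P f → (moved X f).Nonempty) :
    IsPt x := by
  refine ⟨A.sep_iff.2 (.inl h), hP, ?_⟩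
  simp only [h.same A, A.before_iff_of_isGLB hp hP hne]
  obtain ⟨l, hl⟩ := exists_lt p
  obtain ⟨c, hc, hs⟩ := A.exists_moved_Ioo hl
  exact ⟨c, hc, fun z hz => (hs hz).2.le⟩

theorem isPt_of_isLUB (A : LinAct X G) {x : Code G} {p : X} (h : Before X x.b x.a)
    (hp : IsLUB (x.union X) p) (hP : ∃ f, x.P f) (hne : ∀ f, x.P f → (moved X f).Nonempty) :
    IsPt x := by
  refine ⟨A.sep_iff.2 (.inr h), hP, ?_⟩
  simp only [h.same' A, A.before_iff_of_isLUB hp hP hne]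
  obtain ⟨r, hr⟩ := exists_gt p
  obtain ⟨c, hc, hs⟩ := A.exists_moved_Ioo hr
  exact ⟨c, hc, fun z hz => (hs hz).1.le⟩

theorem exists_code (A : LinAct X G) (p : X) :
    ∃ (a b : G) (P : G → Prop), ∀ f, IsPt ⟨a, b, f, P⟩ ∧ PtOf ⟨a, b, f, P⟩ p := by
  obtain ⟨s, t, hst⟩ := A.exists_before p
  -- All nonempty supports above `p` are taken; some of them lie in each interval just to the right
  -- of `p`, so their infimum is `p`.
  let P : G → Prop := fun f => (moved X f).Nonempty ∧ ∀ z ∈ moved X f, p ≤ z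
  have hglb : ∀ f, IsGLB (Code.union X ⟨s, t, f, P⟩) p := by
    refine fun f => ⟨fun z ⟨f, hf, hz⟩ => hf.2 z hz, fun w hw => ?_⟩
    by_contra! hpw
    obtain ⟨c, ⟨z, hz⟩, hs⟩ := A.exists_moved_Ioo hpw
    exact (hw ⟨c, ⟨⟨z, hz⟩, fun z hz => (hs hz).1.le⟩, hz⟩).not_gt (hs hz).2
  obtain ⟨r, hr⟩ := exists_gt p
  obtain ⟨c, hc, hs⟩ := A.exists_moved_Ioo hr
  exact ⟨s, t, P, fun f => ⟨A.isPt_of_isGLB hst (hglb f) ⟨c, hc, fun z hz => (hs hz).1.le⟩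
    fun f hf => hf.1, .inl ⟨hst, hglb f⟩⟩⟩

end LinAct

/-! ### The Dedekind completion -/

namespace DCompl

variable {L : Type u} [LinearOrder L]

theorem of_le_iff {l : L} {x : DCompl L} : of l ≤ x ↔ l ∈ x.1.left :=
  DedekindCut.principal_le_iff

theorem le_of_iff {l : L} {x : DCompl L} : x ≤ of l ↔ l ∈ x.1.right :=
  DedekindCut.le_principal_iff

theorem of_le_of {l m : L} : of l ≤ of m ↔ l ≤ m := of_le_iff

theorem of_lt_of {l m : L} : of l < of m ↔ l < m := lt_iff_lt_of_le_iff_le of_le_of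

theorem exists_of_le (x : DCompl L) : ∃ l, of l ≤ x :=
  x.2.1.imp fun _ h => of_le_iff.2 h

theorem exists_le_of (x : DCompl L) : ∃ l, x ≤ of l :=
  x.2.2.imp fun _ h => le_of_iff.2 h

/-- The supremum among all cuts lies between an element of `S` and a bound of `S`, so both of its
halves are nonempty. -/
theorem exists_isLUB (S : Set (DCompl L)) (hS : S.Nonempty) (hb : BddAbove S) :
    ∃ x, IsLUB S x := by
  obtain ⟨y, hy⟩ := hS
  obtain ⟨b, hb⟩ := hb
  have hyc : y.1 ≤ sSup (Subtype.val '' S) := le_sSup ⟨y, hy, rfl⟩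
  have hcb : sSup (Subtype.val '' S) ≤ b.1 := sSup_le (by rintro _ ⟨z, hz, rfl⟩; exact hb hz)
  refine ⟨⟨sSup (Subtype.val '' S), y.2.1.mono (Concept.extent_subset_extent_iff.2 hyc),
    b.2.2.mono (Concept.intent_subset_intent_iff.2 hcb)⟩, fun z hz => ?_, fun z hz => ?_⟩
  · exact le_sSup (α := DedekindCut L) ⟨z, hz, rfl⟩
  · exact sSup_le (α := DedekindCut L) (by rintro _ ⟨w, hw, rfl⟩; exact hz hw)

theorem exists_isGLB (S : Set (DCompl L)) (hS : S.Nonempty) (hb : BddBelow S) :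
    ∃ x, IsGLB S x := by
  obtain ⟨x, hx⟩ := exists_isLUB (lowerBounds S) hb (hS.mono fun y hy z hz => hz hy)
  exact ⟨x, isLUB_lowerBounds.1 hx⟩

variable [DenselyOrdered L]

/-- Some `l` in the lower half of `y` is not a lower bound of the upper half of `x`; density of `L`
below `l` makes both inequalities strict. -/
theorem exists_of_between {x y : DCompl L} (h : x < y) : ∃ l, x < of l ∧ of l < y := by
  obtain ⟨l, hly, hlx⟩ : ∃ l ∈ y.1.left, l ∉ x.1.left :=
    not_subset.1 fun h' => h.not_ge (Concept.extent_subset_extent_iff.1 h')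
  rw [← DedekindCut.lowerBounds_right] at hlx
  obtain ⟨r, hr, hrl⟩ : ∃ r ∈ x.1.right, r < l := by
    simpa [lowerBounds] using hlx
  obtain ⟨m, hm, hm'⟩ := exists_between hrl
  exact ⟨m, (le_of_iff.2 hr).trans_lt (of_lt_of.2 hm), (of_lt_of.2 hm').trans_le (of_le_iff.2 hly)⟩

instance : DenselyOrdered (DCompl L) where
  dense _ _ h := by
    obtain ⟨l, hl⟩ := exists_of_between h
    exact ⟨_, hl⟩

instance [NoMinOrder L] : NoMinOrder (DCompl L) where
  exists_lt x := by
    obtain ⟨l, hl⟩ := exists_of_le x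
    obtain ⟨m, hm⟩ := exists_lt l
    exact ⟨_, (of_lt_of.2 hm).trans_le hl⟩

instance [NoMaxOrder L] : NoMaxOrder (DCompl L) where
  exists_gt x := by
    obtain ⟨l, hl⟩ := exists_le_of x
    obtain ⟨m, hm⟩ := exists_gt l
    exact ⟨_, hl.trans_lt (of_lt_of.2 hm)⟩

theorem exists_Ioo_subset [NoMinOrder L] [NoMaxOrder L] {x : DCompl L} {V : Set (DCompl L)}
    (hV : V ∈ 𝓝 x) : ∃ l m : L, l < m ∧ ∀ z, l < z → z < m → of z ∈ V := by
  obtain ⟨a, b, h, hab⟩ := mem_nhds_iff_exists_Ioo_subset.1 hV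
  obtain ⟨l, hl, hl'⟩ := exists_of_between h.1
  obtain ⟨m, hm, hm'⟩ := exists_of_between h.2
  exact ⟨l, m, of_lt_of.1 (hl'.trans hm), fun z h1 h2 =>
    hab ⟨hl.trans (of_lt_of.2 h1), (of_lt_of.2 h2).trans hm'⟩⟩

end DCompl

/-! ### The groups of the class `K` satisfy the abstract properties -/

theorem supp_strictMono {L : Type u} [LinearOrder L] (g : L ≃o L) :
    StrictMono fun x : DCompl L => g • x :=
  (extendIso g).strictMono

theorem IntervalTransitive.exists_mem {L : Type u} [LinearOrder L] {G : Subgroup (L ≃o L)}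
    (h : IntervalTransitive 2 G) {I₁ I₂ J₁ J₂ : Set L} (hI₁ : IsInterval I₁) (hI₂ : IsInterval I₂)
    (hJ₁ : IsInterval J₁) (hJ₂ : IsInterval J₂) (nI₁ : I₁.Nonempty) (nI₂ : I₂.Nonempty)
    (nJ₁ : J₁.Nonempty) (nJ₂ : J₂.Nonempty) (hI : ∀ x ∈ I₁, ∀ y ∈ I₂, x < y)
    (hJ : ∀ x ∈ J₁, ∀ y ∈ J₂, x < y) :
    ∃ g ∈ G, (∃ x ∈ I₁, g x ∈ J₁) ∧ ∃ x ∈ I₂, g x ∈ J₂ := by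
  have key : ∀ {I₁ I₂ : Set L}, I₁.Nonempty → I₂.Nonempty → (∀ x ∈ I₁, ∀ y ∈ I₂, x < y) →
      SetsLT ![I₁, I₂] := by
    intro I₁ I₂ h1 h2 h
    refine ⟨fun i => ?_, fun x hx => ?_⟩
    · fin_cases i
      exacts [h1, h2]
    · rw [Fin.strictMono_iff_lt_succ]
      intro i
      obtain rfl := Subsingleton.elim i 0
      exact h _ (hx 0) _ (hx 1)
  obtain ⟨g, hg, H⟩ := h ![I₁, I₂] ![J₁, J₂]
    (fun i => by fin_cases i; exacts [hI₁, hI₂]) (fun i => by fin_cases i; exacts [hJ₁, hJ₂])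
    (key nI₁ nI₂ hI) (key nJ₁ nJ₂ hJ)
  obtain ⟨_, ⟨x, hx, rfl⟩, hx'⟩ := H 0
  obtain ⟨_, ⟨y, hy, rfl⟩, hy'⟩ := H 1
  exact ⟨g, hg, ⟨x, hx, hx'⟩, y, hy, hy'⟩

theorem KLN.linAct (P : KLN.{u} 2) : LinAct (DCompl P.L) P.G where
  mono g := supp_strictMono g.1
  cont g := (extendIso g.1).continuous
  faithful g h := by
    refine Subtype.ext (RelIso.ext fun l => ?_)
    have h1 : (g.1 • DCompl.of l : DCompl P.L) = DCompl.of l := h (DCompl.of l)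
    rw [smul_of] at h1
    exact le_antisymm (DCompl.of_le_of.1 h1.le) (DCompl.of_le_of.1 h1.ge)
  exists_supp u v huv := by
    obtain ⟨g, hg, hg1, x, y, hxy, hs⟩ := P.exists_bounded
    obtain ⟨l₂, h₁, h₃⟩ := DCompl.exists_of_between huv
    obtain ⟨l₁, h₁, h₂⟩ := DCompl.exists_of_between h₁
    obtain ⟨l₃, h₃, h₄⟩ := DCompl.exists_of_between h₃
    rw [DCompl.of_lt_of] at h₂ h₃
    obtain ⟨a, ha⟩ := DCompl.exists_of_le x
    obtain ⟨b, hb⟩ := DCompl.exists_le_of y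
    have hab : a < b := DCompl.of_lt_of.1 (ha.trans_lt (hxy.trans_le hb))
    -- The rays below `a` and above `b` flank the support of `g`. Moving a point of each into
    -- adjacent intervals inside `(u, v)` traps the image of the support between them.
    obtain ⟨h, hh, ⟨a', ha', hua⟩, b', hb', hvb⟩ := P.intervalTransitive.exists_mem
      (I₁ := Iio a) (I₂ := Ioi b) (J₁ := Ioo l₁ l₂) (J₂ := Ioo l₂ l₃)
      (.inr (.inl ⟨a, rfl⟩)) (.inr (.inr (.inl ⟨b, rfl⟩))) (.inl ⟨_, _, h₂, rfl⟩)
      (.inl ⟨_, _, h₃, rfl⟩) nonempty_Iio nonempty_Ioi (nonempty_Ioo.2 h₂) (nonempty_Ioo.2 h₃)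
      (fun x hx y hy => hx.trans (hab.trans hy)) (fun x hx y hy => hx.2.trans hy.1)
    refine ⟨⟨h * g * h⁻¹, P.G.mul_mem (P.G.mul_mem hh hg) (P.G.inv_mem hh)⟩, ?_, fun z hz => ?_⟩
    · intro h'
      have h' := congrArg Subtype.val h'
      simp only [Subgroup.coe_one, mul_inv_eq_one, mul_eq_left] at h'
      exact hg1 h'
    · have hz' : z ∈ supp (h * g * h⁻¹) := hz
      rw [supp_conj] at hz'
      obtain ⟨w, hw, rfl⟩ := hz'
      have hm := supp_strictMono h
      constructor
      · have h1 : DCompl.of a' < w := (DCompl.of_lt_of.2 ha').trans_le (ha.trans (hs hw).1.le)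
        have h2 := hm h1
        simp only [smul_of] at h2
        exact (‹u < _›.trans (DCompl.of_lt_of.2 hua.1)).trans h2
      · have h1 : w < DCompl.of b' := ((hs hw).2.le.trans hb).trans_lt (DCompl.of_lt_of.2 hb')
        have h2 := hm h1
        simp only [smul_of] at h2
        exact h2.trans ((DCompl.of_lt_of.2 hvb.2).trans h₄)
  trans x y x' y' h h' U hU V hV U' hU' V' hV' := by
    have key : ∀ {x y : DCompl P.L}, x < y → ∀ {U V : Set (DCompl P.L)}, U ∈ 𝓝 x → V ∈ 𝓝 y →
        ∃ I J : Set P.L, IsInterval I ∧ IsInterval J ∧ I.Nonempty ∧ J.Nonempty ∧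
          (∀ x ∈ I, ∀ y ∈ J, x < y) ∧ (∀ x ∈ I, DCompl.of x ∈ U) ∧ ∀ x ∈ J, DCompl.of x ∈ V := by
      intro x y h U V hU hV
      obtain ⟨m, hm, hm'⟩ := exists_between h
      obtain ⟨a, b, hab, h1⟩ := DCompl.exists_Ioo_subset (inter_mem hU (Iio_mem_nhds hm))
      obtain ⟨c, d, hcd, h2⟩ := DCompl.exists_Ioo_subset (inter_mem hV (Ioi_mem_nhds hm'))
      refine ⟨Ioo a b, Ioo c d, .inl ⟨_, _, hab, rfl⟩, .inl ⟨_, _, hcd, rfl⟩, nonempty_Ioo.2 hab,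
        nonempty_Ioo.2 hcd, fun x hx y hy => ?_, fun x hx => (h1 x hx.1 hx.2).1,
        fun x hx => (h2 x hx.1 hx.2).1⟩
      exact DCompl.of_lt_of.1 (lt_trans (h1 x hx.1 hx.2).2 (h2 y hy.1 hy.2).2)
    obtain ⟨I, J, hI, hJ, nI, nJ, hIJ, hIU, hJV⟩ := key h hU hV
    obtain ⟨I', J', hI', hJ', nI', nJ', hIJ', hIU', hJV'⟩ := key h' hU' hV'
    obtain ⟨g, hg, ⟨z, hz, hz'⟩, w, hw, hw'⟩ :=
      P.intervalTransitive.exists_mem hI hJ hI' hJ' nI nJ nI' nJ' hIJ hIJ'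
    refine ⟨⟨g, hg⟩, ⟨_, hIU z hz, ?_⟩, _, hJV w hw, ?_⟩
    · have := hIU' _ hz'
      rwa [← smul_of] at this
    · have := hJV' _ hw'
      rwa [← smul_of] at this
  lub := DCompl.exists_isLUB
  glb := DCompl.exists_isGLB

/-! ### Endpoints -/

section Endpoints

variable {L : Type u} [LinearOrder L]

theorem isOpen_supp (g : L ≃o L) : IsOpen (supp g) :=
  (isClosed_eq (extendIso g).continuous continuous_id).isOpen_compl

theorem upperBounds_hull {X : Type u} [LinearOrder X] (S : Set X) :
    upperBounds (hull S) = upperBounds S := by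
  ext x
  exact ⟨fun h y hy => h ⟨y, hy, y, hy, le_rfl, le_rfl⟩,
    fun h z ⟨_, _, y, hy, _, hz⟩ => hz.trans (h hy)⟩

theorem lowerBounds_hull {X : Type u} [LinearOrder X] (S : Set X) :
    lowerBounds (hull S) = lowerBounds S := by
  ext x
  exact ⟨fun h y hy => h ⟨y, hy, y, hy, le_rfl, le_rfl⟩,
    fun h z ⟨y, hy, _, _, hz, _⟩ => (h hy).trans hz⟩

theorem supp_subset_var (g : L ≃o L) : supp g ⊆ var g :=
  interior_maximal subset_closure (isOpen_supp g)

/-- `var g` lies between the open set `supp g` and its closure, and neither closures nor convex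
hulls change upper bounds. -/
theorem isLUB_hull_var {g : L ≃o L} {x : DCompl L} : IsLUB (hull (var g)) x ↔ IsLUB (supp g) x := by
  have h : upperBounds (hull (var g)) = upperBounds (supp g) := by
    rw [upperBounds_hull]
    refine (upperBounds_mono_set (supp_subset_var g)).antisymm ?_
    rw [← upperBounds_closure (supp g)]
    exact upperBounds_mono_set interior_subset
  rw [IsLUB, IsLUB, h]

theorem isGLB_hull_var {g : L ≃o L} {x : DCompl L} : IsGLB (hull (var g)) x ↔ IsGLB (supp g) x := by
  have h : lowerBounds (hull (var g)) = lowerBounds (supp g) := by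
    rw [lowerBounds_hull]
    refine (lowerBounds_mono_set (supp_subset_var g)).antisymm ?_
    rw [← lowerBounds_closure (supp g)]
    exact lowerBounds_mono_set interior_subset
  rw [IsGLB, IsGLB, h]

theorem mem_EP {G : Subgroup (L ≃o L)} {x : DCompl L} :
    x ∈ EP G ↔ ∃ g : G, IsLUB (moved (DCompl L) g) x ∨ IsGLB (moved (DCompl L) g) x := by
  constructor
  · rintro ⟨g, hg, h⟩
    exact ⟨⟨g, hg⟩, h.imp isLUB_hull_var.1 isGLB_hull_var.1⟩
  · rintro ⟨g, h⟩
    exact ⟨g, g.2, h.imp isLUB_hull_var.2 isGLB_hull_var.2⟩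

end Endpoints

/-! ### The interpretations -/

/-- The code given by a triple of group elements. -/
def foCode {G : Type u} [Group G] (a : Fin 3 → G) : Code G := ⟨a 0, a 1, a 2, fun x => x = a 2⟩

theorem union_foCode {X G : Type u} [Group G] [MulAction G X] (a : Fin 3 → G) :
    (foCode a).union X = moved X (a 2) := by
  ext z
  simp [Code.union, foCode]

theorem KLN.ptOf_mem_EP (P : KLN.{u} 2) (a : Fin 3 → P.G) (h : IsPt (foCode a)) :
    ∃ y : EP P.G, LinAct.PtOf (foCode a) (y : DCompl P.L) := by
  obtain ⟨p, hp⟩ := P.linAct.exists_ptOf h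
  refine ⟨⟨p, mem_EP.2 ⟨a 2, ?_⟩⟩, hp⟩
  rw [← union_foCode]
  exact hp.elim (fun h => .inr h.2) fun h => .inl h.2

theorem KLN.exists_foCode (P : KLN.{u} 2) (y : EP P.G) :
    ∃ a : Fin 3 → P.G, IsPt (foCode a) ∧ LinAct.PtOf (foCode a) (y : DCompl P.L) := by
  obtain ⟨p, hp⟩ := y
  obtain ⟨g, hg⟩ := mem_EP.1 hp
  obtain ⟨s, t, hst⟩ := P.linAct.exists_before p
  rcases hg with hg | hg
  -- The empty set has no least upper bound here, as the completion has no least element. The pair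
  -- is then listed as `t`, `s`, so that the supremum becomes an infimum in the coded orientation.
  · have hne : (moved (DCompl P.L) g).Nonempty := hg.nonempty
    replace hg : IsLUB ((foCode ![t, s, g]).union (DCompl P.L)) p := by rwa [union_foCode]
    refine ⟨![t, s, g], P.linAct.isPt_of_isLUB hst hg ⟨g, rfl⟩ ?_, .inr ⟨hst, hg⟩⟩
    rintro _ rfl
    exact hne
  · have hne : (moved (DCompl P.L) g).Nonempty := hg.nonempty
    replace hg : IsGLB ((foCode ![s, t, g]).union (DCompl P.L)) p := by rwa [union_foCode]
    refine ⟨![s, t, g], P.linAct.isPt_of_isGLB hst hg ⟨g, rfl⟩ ?_, .inl ⟨hst, hg⟩⟩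
    rintro _ rfl
    exact hne

theorem foStrInterpretable :
    FOStrInterpretable groupLang (actLang edLang) (fun P : KLN.{u} 2 => P.G)
      (fun P : KLN.{u} 2 => Act (EP P.G) P.G) (fun _ => Function.Embedding.inr) := by
  obtain ⟨φU, hU⟩ := ((Dfn.isGp 0 1 2 ()).or (Dfn.isPt.{u} 0 1 2 ())).exists_formula
    (γ := Fin 3) id fun _ => 2
  obtain ⟨φEq, hEq⟩ := (Dfn.codeEq.{u} (.inl 0) (.inl 1) (.inl 2) true
    (.inr 0) (.inr 1) (.inr 2) false).exists_formula (γ := Fin 3 ⊕ Fin 3) id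
    fun b => cond b (.inl 2) (.inr 2)
  have hR : ∀ (m : ℕ) (R : (actLang edLang).Relations m), _ := fun m R =>
    (Dfn.codeRel.{u} R).exists_formula id fun j => (j, 2)
  choose φR hR using hR
  obtain ⟨φI, hI⟩ := ((Dfn.isGp (.inl 0) (.inl 1) (.inl 2) ()).and
    (Dfn.eq.{u} (.inl 2) (.inr ()))).exists_formula (γ := Fin 3 ⊕ Unit) id fun _ => .inl 2
  refine ⟨3, φU, φEq, φR, φI, fun P => ?_⟩
  obtain ⟨μ, h1, h2, h3, h4⟩ := P.linAct.exists_decoding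
    (ι := fun y : EP P.G => (y : DCompl P.L)) (fun _ _ => Iff.rfl)
    Subtype.val_injective (fun _ _ => rfl) (code := foCode) (U := φU.Realize)
    (fun a => hU _ _) P.ptOf_mem_EP P.exists_foCode fun g => ⟨![1, 1, g], rfl, rfl⟩
  exact ⟨μ, h1, fun a b => (h2 a b).trans (hEq P.G (Sum.elim a.1 b.1)).symm,
    fun m R a => (h3 m R a).trans (hR m R P.G fun p => (a p.1).1 p.2).symm,
    fun a b => (hI _ _).trans (h4 a b)⟩

/-- The variables of the second order formulas: three element variables and a variable for a set. -/
inductive SOVar : VarKind → Type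
  | el (i : Fin 3) : SOVar .elem
  | pr : SOVar (.rel 1)

instance : Finite (Σ κ : VarKind, SOVar κ) :=
  Finite.of_surjective (fun o : Option (Fin 3) =>
    o.elim (⟨.rel 1, .pr⟩ : Σ κ : VarKind, SOVar κ) fun i => ⟨.elem, .el i⟩) <| by
    rintro ⟨_, ⟨i⟩ | ⟨⟩⟩
    exacts [⟨some i, rfl⟩, ⟨none, rfl⟩]

/-- The code given by three group elements and a set. -/
def soCode {G : Type u} [Group G] (v : Assignment SOVar G) : Code G :=
  ⟨v _ (.el 0), v _ (.el 1), v _ (.el 2), fun x => v _ .pr fun _ => x⟩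

/-- The assignment of three group elements and a set to the variables. -/
def soAssign {G : Type u} [Group G] (a b f : G) (P : G → Prop) : Assignment SOVar G
  | _, .el i => ![a, b, f] i
  | _, .pr => fun x => P (x 0)

theorem soStrInterpretable :
    SOStrInterpretable groupLang (actLang edLang) (fun P : KLN.{u} 2 => P.G)
      (fun P : KLN.{u} 2 => Act (DCompl P.L) P.G) (fun _ => Function.Embedding.inr) := by
  obtain ⟨φU, hU⟩ := ((Dfn.isGp 0 1 2 ()).or (Dfn.isPt.{u} 0 1 2 ())).exists_soFormula
    (X := SOVar) .el fun _ => .pr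
  obtain ⟨φEq, hEq⟩ := (Dfn.codeEq.{u} (.inl 0) (.inl 1) (.inl 2) true
    (.inr 0) (.inr 1) (.inr 2) false).exists_soFormula (X := fun κ => SOVar κ ⊕ SOVar κ)
    (Sum.map .el .el) fun b => cond b (.inl .pr) (.inr .pr)
  have hR : ∀ (m : ℕ) (R : (actLang edLang).Relations m), _ := fun m R =>
    (Dfn.codeRel.{u} R).exists_soFormula (X := fun κ => Fin m × SOVar κ)
      (fun p => (p.1, .el p.2)) fun j => (j, .pr)
  choose φR hR using hR
  obtain ⟨φI, hI⟩ := ((Dfn.isGp (.inl 0) (.inl 1) (.inl 2) ()).and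
    (Dfn.eq.{u} (.inl 2) (.inr ()))).exists_soFormula (X := Ext SOVar .elem)
    (Sum.elim (fun i => .old (.el i)) fun _ : Unit => .new) fun _ => .old .pr
  refine ⟨SOVar, inferInstance, φU, φEq, φR, φI, fun P => ?_⟩
  obtain ⟨μ, h1, h2, h3, h4⟩ := P.linAct.exists_decoding (ι := id) (fun _ _ => Iff.rfl)
    Function.injective_id (fun _ _ => rfl) (code := soCode) (U := φU.Realize)
    (fun a => hU _ _) (fun a h => P.linAct.exists_ptOf h)
    (fun p => by
      obtain ⟨a, b, Q, h⟩ := P.linAct.exists_code p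
      -- The third element does not affect the point coded; `1` is a filler, as is the empty set in
      -- the codes of group elements below.
      exact ⟨soAssign a b 1 Q, h 1⟩)
    fun g => ⟨soAssign 1 1 g fun _ => False, rfl, rfl⟩
  exact ⟨μ, h1, fun a b => (h2 a b).trans (hEq P.G fun κ => Sum.elim (a.1 κ) (b.1 κ)).symm,
    fun m R a => (h3 m R a).trans (hR m R P.G fun κ p => (a p.1).1 κ p.2).symm,
    fun a b => (hI _ _).trans (h4 a b)⟩

end LinInterp

theorem mainTheorem5 :
    -- (1): `EPACT(L, G) = ACT(EP(L, G), G)` in `G`, first order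
    LinInterp.FOStrInterpretable LinInterp.groupLang (LinInterp.actLang LinInterp.edLang)
      (fun P : LinInterp.KLN.{u} 2 => P.G)
      (fun P : LinInterp.KLN.{u} 2 => LinInterp.Act (LinInterp.EP P.G) P.G)
      (fun _ => Function.Embedding.inr) ∧
    -- (2): `DCACT(L, G)`, the action of `G` on the equal direction structure of the completion,
    -- in `G`, second order
    LinInterp.SOStrInterpretable LinInterp.groupLang (LinInterp.actLang LinInterp.edLang)
      (fun P : LinInterp.KLN.{u} 2 => P.G)
      (fun P : LinInterp.KLN.{u} 2 => LinInterp.Act (LinInterp.DCompl P.L) P.G)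
      (fun _ => Function.Embedding.inr) :=
  ⟨LinInterp.foStrInterpretable, LinInterp.soStrInterpretable⟩
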